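/- **Setting.** Let $\mathcal D$ be a class of finite groups and, for $G,H\in\mathcal D$, let $\mathcal S_{G,H}$ be a set of subgroups $L\le G\times H$ with $k_1(L):=\{g\mid (g,1)\in L\}=1$. Assume that (i) each $\mathcal S_{G,H}$ is closed under $G\times H$-conjugation; (ii) each $\mathcal S_{G,H}$ is closed under taking subgroups; (iii) if $L\in\mathcal S_{G,H}$ and $M\in\mathcal S_{H,K}$, then $L*M:=\{(g,k)\mid \exists h\in H:\ (g,h)\in L,\ (h,k)\in M\}\in\mathcal S_{G,K}$; (iv) $\Delta(G):=\{(g,g)\mid g\in G\}\in\mathcal S_{G,G}$. Let $B(G,H)$ be the Grothendieck group of finite $(G,H)$-bisets (with respect to disjoint union), equivalently of finite $G\times H$-sets via $(g,h)x=gxh^{-1}$; the tensor product $X\times_H Y$ of bisets induces bilinear maps $-\cdot_H-\colon B(G,H)\times B(H,K)\to B(G,K)$, and makes $B(G,G)$ a ring. Let $\Phi_L\colon B(G,H)\to\mathbb Z$, $[X]\mapsto|X^L|$, for $L\le G\times H$. Let $B^{\mathcal S}(G,H)$ be the subgroup of $B(G,H)$ spanned by the classes $[(G\times H)/L]$ with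 $L\in\mathcal S_{G,H}$. For $U\le G$, $V\le H$ and an epimorphism $\alpha\colon V\to U$ put $\lhd(U,\alpha,V):=\{(\alpha(h),h)\mid h\in V\}$, written $\Delta(U,\alpha,V)$ and called twisted diagonal if $\alpha$ is an isomorphism. Let $\Delta(\mathcal S)_{G,H}$ be the set of twisted diagonal subgroups in $\mathcal S_{G,H}$. For $n\ge0$ let $B^{\mathcal S}_n(G,H)$ be the set of all $a\in B^{\mathcal S}(G,H)$ such that $\Phi_{\lhd(U,\alpha,V)}(a)=0$ for all $(U,\alpha,V)$ for which the composition length of $\ker(\alpha)$ is different from $n$. For a commutative ring $R$, the prefix $R$ denotes $R\otimes_{\mathbb Z}-$; here $RB^{\mathcal S}(G,H)$ and $RB_n^{\mathcal S}(G,H)$ are regarded as the $R$-submodules of $RB(G,H)$ spanned by $B^{\mathcal S}(G,H)$ and $B^{\mathcal S}_n(G,H)$, and $\cdot_H$, $\Phi_L$ are extended $R$-linearly. For $U\le G$ let $\mathrm{Aut}_{\Delta(\mathcal S)_G}(U)$ be the group of all $\varphi\in\mathrm{Aut}(U)$ with $\{(\varphi(u),u)\mid u\in U\}\in\Delta(\mathcal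 S)_{G,G}$, and let $\mathrm{Out}_{\Delta(\mathcal S)_G}(U):=\mathrm{Aut}_{\Delta(\mathcal S)_G}(U)/\mathrm{Inn}(U)$. **Theorem 6.4.** Let $G,H,K\in\mathcal D$. (a) For every commutative ring $R$ and all $m,n\ge 0$, $$RB^{\mathcal S}_m(G,H)\cdot_H RB^{\mathcal S}_n(H,K)\subseteq RB^{\mathcal S}_{m+n}(G,K).$$ (b) If $R$ is a commutative ring in which $|G|$ is invertible, then $RB^{\mathcal S}(G,G)=\bigoplus_{n\ge0}RB_n^{\mathcal S}(G,G)$, this makes $RB^{\mathcal S}(G,G)$ a graded $R$-algebra, and $RB_0^{\mathcal S}(G,G)=RB^{\Delta(\mathcal S)}(G,G)$. (c) Let $R$ be a field in which $|G|$ and $|\mathrm{Out}_{\Delta(\mathcal S)_G}(U)|$, for every subgroup $U\le G$, are invertible, and assume that $\Delta(\mathcal S)_{G,G}$ is closed under passing to the opposite subgroup $L^\circ=\{(h,g)\mid(g,h)\in L\}$. Let $J$ be the Jacobson radical of $RB^{\mathcal S}(G,G)$. Then $J=\bigoplus_{n\ge1}RB_n^{\mathcal S}(G,G)$; moreover, $J$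 consists precisely of those $a\in RB^{\mathcal S}(G,G)$ with $\Phi_{\Delta(U,\alpha,V)}(a)=0$ for all $\Delta(U,\alpha,V)\in\Delta(\mathcal S)_{G,G}$; and $$RB^{\mathcal S}(G,G)=RB^{\Delta(\mathcal S)}(G,G)\oplus J.$$ -/

import Mathlib

open scoped TensorProduct

universe u v w

/-- A `(G, H)`-biset, as a finite set with an action of `G × H`: the left action of `G` and the
right action of `H` are recovered by `g x h = (g, h⁻¹) • x`. -/
structure Biset (G H : Type u) [Group G] [Group H] where
  carrier : Type u
  [finite : Finite carrier]
  [action : MulAction (G × H) carrier]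

attribute [instance] Biset.finite Biset.action

namespace Biset

variable {G H K L : Type u} [Group G] [Group H] [Group K] [Group L]

/-- Isomorphism of bisets: an equivariant bijection. -/
def Iso (X Y : Biset G H) : Prop :=
  ∃ e : X.carrier ≃ Y.carrier, ∀ (a : G × H) (x : X.carrier), e (a • x) = a • e x

theorem Iso.refl (X : Biset G H) : Iso X X := ⟨Equiv.refl _, fun _ _ => rfl⟩

theorem Iso.symm {X Y : Biset G H} : Iso X Y → Iso Y X := by
  rintro ⟨e, he⟩
  exact ⟨e.symm, fun a y => by rw [Equiv.symm_apply_eq, he, Equiv.apply_symm_apply]⟩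

theorem Iso.trans {X Y Z : Biset G H} : Iso X Y → Iso Y Z → Iso X Z := by
  rintro ⟨e, he⟩ ⟨f, hf⟩
  exact ⟨e.trans f, fun a x => by simp [he, hf]⟩

instance isoSetoid (G H : Type u) [Group G] [Group H] : Setoid (Biset G H) :=
  ⟨Iso, ⟨Iso.refl, Iso.symm, Iso.trans⟩⟩

theorem iso_of_bijective {X Y : Biset G H} (f : X.carrier → Y.carrier) (hf : Function.Bijective f)
    (hs : ∀ (a : G × H) (x : X.carrier), f (a • x) = a • f x) : Iso X Y :=
  ⟨Equiv.ofBijective f hf, hs⟩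

/-- The empty biset. -/
def empty (G H : Type u) [Group G] [Group H] : Biset G H where
  carrier := PEmpty
  action := { smul := fun _ x => x, one_smul := fun _ => rfl, mul_smul := fun _ _ _ => rfl }

/-- The disjoint union of two bisets. -/
def sum (X Y : Biset G H) : Biset G H where
  carrier := X.carrier ⊕ Y.carrier
  action :=
    { smul := fun a => Sum.map (a • ·) (a • ·)
      one_smul := by rintro (x | x) <;> exact congrArg _ (one_smul _ x)
      mul_smul := by rintro a b (x | x) <;> exact congrArg _ (mul_smul a b x) }

theorem sum_smul_inl (X Y : Biset G H) (a : G × H) (x : X.carrier) :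
    a • (Sum.inl x : (sum X Y).carrier) = (Sum.inl (a • x) : X.carrier ⊕ Y.carrier) := rfl

theorem sum_smul_inr (X Y : Biset G H) (a : G × H) (y : Y.carrier) :
    a • (Sum.inr y : (sum X Y).carrier) = (Sum.inr (a • y) : X.carrier ⊕ Y.carrier) := rfl

/-- The transitive biset `(G × H) / L`. -/
def coset (L : Subgroup (G × H)) [Finite ((G × H) ⧸ L)] : Biset G H where
  carrier := (G × H) ⧸ L

/-- The group `G` as a `(G, G)`-biset under left and right multiplication. -/
def regular (G : Type u) [Group G] [Finite G] : Biset G G where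
  carrier := G
  action :=
    { smul := fun a x => a.1 * x * a.2⁻¹
      one_smul := fun x => by
        change (1 : G) * x * (1 : G)⁻¹ = x
        simp
      mul_smul := fun a b x => by
        change (a.1 * b.1) * x * (a.2 * b.2)⁻¹ = a.1 * (b.1 * x * b.2⁻¹) * a.2⁻¹
        simp [mul_assoc] }

theorem regular_smul [Finite G] (a : G × G) (x : G) :
    (a • (show (regular G).carrier from x) : (regular G).carrier) = (a.1 * x * a.2⁻¹ : G) := rfl

/-- The relation on `X × Y` whose classes are the orbits of `H` acting by
`h (x, y) = (x h⁻¹, h y)`. -/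
def tensorSetoid (X : Biset G H) (Y : Biset H K) : Setoid (X.carrier × Y.carrier) where
  r p q := ∃ h : H, q.1 = ((1, h) : G × H) • p.1 ∧ q.2 = ((h, 1) : H × K) • p.2
  iseqv :=
    { refl := fun p => ⟨1, (one_smul (G × H) p.1).symm, (one_smul (H × K) p.2).symm⟩
      symm := by
        rintro p q ⟨h, h1, h2⟩
        refine ⟨h⁻¹, ?_, ?_⟩
        · rw [h1, smul_smul]; simp [← Prod.one_eq_mk]
        · rw [h2, smul_smul]; simp [← Prod.one_eq_mk]
      trans := by
        rintro p q r ⟨h, h1, h2⟩ ⟨k, k1, k2⟩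
        refine ⟨k * h, ?_, ?_⟩
        · rw [k1, h1, smul_smul]; simp
        · rw [k2, h2, smul_smul]; simp }

/-- The tensor product `X ×_H Y` of bisets, with `g (x ×_H y) k = (g x) ×_H (y k)`. -/
def tensor (X : Biset G H) (Y : Biset H K) : Biset G K where
  carrier := Quotient (tensorSetoid X Y)
  finite := Quotient.finite _
  action :=
    { smul := fun a => Quotient.map
        (fun p => (((a.1, 1) : G × H) • p.1, ((1, a.2) : H × K) • p.2)) (by
          rintro p q ⟨h, h1, h2⟩
          exact ⟨h, by simp [h1, smul_smul], by simp [h2, smul_smul]⟩)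
      one_smul := by
        rintro ⟨p⟩
        exact Quotient.sound ⟨1, by simp [← Prod.one_eq_mk], by simp [← Prod.one_eq_mk]⟩
      mul_smul := by
        rintro a b ⟨p⟩
        exact Quotient.sound ⟨1, by simp [smul_smul], by simp [smul_smul]⟩ }

/-- The element `x ×_H y`. -/
def tmk (X : Biset G H) (Y : Biset H K) (x : X.carrier) (y : Y.carrier) : (tensor X Y).carrier :=
  Quotient.mk (tensorSetoid X Y) (x, y)

theorem tmk_surj {X : Biset G H} {Y : Biset H K} (t : (tensor X Y).carrier) :
    ∃ x y, tmk X Y x y = t := by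
  obtain ⟨⟨x, y⟩⟩ := t
  exact ⟨x, y, rfl⟩

theorem tmk_eq_iff {X : Biset G H} {Y : Biset H K} {x x' : X.carrier} {y y' : Y.carrier} :
    tmk X Y x y = tmk X Y x' y' ↔
      ∃ h : H, x' = ((1, h) : G × H) • x ∧ y' = ((h, 1) : H × K) • y :=
  Quotient.eq (r := tensorSetoid X Y)

theorem smul_tmk {X : Biset G H} {Y : Biset H K} (a : G × K) (x : X.carrier) (y : Y.carrier) :
    a • tmk X Y x y = tmk X Y (((a.1, 1) : G × H) • x) (((1, a.2) : H × K) • y) := rfl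

/-- Construct an isomorphism out of a tensor product. -/
theorem tensor_iso {X : Biset G H} {Y : Biset H K} {Z : Biset G K}
    (f : X.carrier → Y.carrier → Z.carrier)
    (hf : ∀ x y x' y', f x y = f x' y' ↔
      ∃ h : H, x' = ((1, h) : G × H) • x ∧ y' = ((h, 1) : H × K) • y)
    (hsurj : ∀ z, ∃ x y, f x y = z)
    (hs : ∀ (a : G × K) x y,
      f (((a.1, 1) : G × H) • x) (((1, a.2) : H × K) • y) = a • f x y) :
    Iso (tensor X Y) Z := by
  refine iso_of_bijective (X := tensor X Y) (Y := Z)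
    (Quotient.lift (fun p => f p.1 p.2) (fun p q h => (hf _ _ _ _).2 h)) ⟨?_, ?_⟩ ?_
  · rintro ⟨x, y⟩ ⟨x', y'⟩ h
    exact tmk_eq_iff.2 ((hf _ _ _ _).1 h)
  · intro z
    obtain ⟨x, y, h⟩ := hsurj z
    exact ⟨tmk X Y x y, h⟩
  · rintro a ⟨x, y⟩
    exact hs a x y

theorem tensor_congr {X X' : Biset G H} {Y Y' : Biset H K} (hX : Iso X X') (hY : Iso Y Y') :
    Iso (tensor X Y) (tensor X' Y') := by
  obtain ⟨e, he⟩ := hX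
  obtain ⟨f, hf⟩ := hY
  refine tensor_iso (fun x y => tmk X' Y' (e x) (f y)) ?_ ?_ ?_
  · intro x y x' y'
    rw [tmk_eq_iff]
    simp only [← he, ← hf, e.injective.eq_iff, f.injective.eq_iff]
  · intro z
    obtain ⟨x, y, rfl⟩ := tmk_surj z
    exact ⟨e.symm x, f.symm y, by simp⟩
  · intro a x y
    simp only [he, hf, smul_tmk]

theorem tensor_assoc (X : Biset G H) (Y : Biset H K) (Z : Biset K L) :
    Iso (tensor (tensor X Y) Z) (tensor X (tensor Y Z)) := by
  refine Iso.symm (tensor_iso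
    (fun x t => Quotient.lift (fun p : Y.carrier × Z.carrier =>
      tmk (tensor X Y) Z (tmk X Y x p.1) p.2) ?_ t) ?_ ?_ ?_)
  · rintro ⟨y, z⟩ ⟨y', z'⟩ ⟨k, h1, h2⟩
    refine tmk_eq_iff.2 ⟨k, ?_, h2⟩
    dsimp only at h1
    rw [smul_tmk, h1]
    exact tmk_eq_iff.2 ⟨1, by simp [← Prod.one_eq_mk], by simp [← Prod.one_eq_mk]⟩
  · intro x t x' t'
    obtain ⟨y, z, rfl⟩ := tmk_surj t
    obtain ⟨y', z', rfl⟩ := tmk_surj t'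
    change tmk (tensor X Y) Z (tmk X Y x y) z = tmk (tensor X Y) Z (tmk X Y x' y') z' ↔ _
    rw [tmk_eq_iff]
    constructor
    · rintro ⟨k, h1, h2⟩
      rw [smul_tmk] at h1
      obtain ⟨h, h3, h4⟩ := tmk_eq_iff.1 h1.symm
      refine ⟨h, by simpa [← Prod.one_eq_mk] using h3, ?_⟩
      rw [smul_tmk]
      exact (tmk_eq_iff.2 ⟨k, by simp [h4, smul_smul], by simp [h2, smul_smul]⟩).symm
    · rintro ⟨h, h1, h2⟩
      rw [smul_tmk] at h2
      obtain ⟨k, h3, h4⟩ := tmk_eq_iff.1 h2.symm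
      refine ⟨k, ?_, by simpa [← Prod.one_eq_mk] using h4⟩
      rw [smul_tmk]
      exact (tmk_eq_iff.2 ⟨h, by simp [h1, smul_smul], by simp [h3, smul_smul]⟩).symm
  · intro t
    obtain ⟨s, z, rfl⟩ := tmk_surj t
    obtain ⟨x, y, rfl⟩ := tmk_surj s
    exact ⟨x, tmk Y Z y z, rfl⟩
  · intro a x t
    obtain ⟨y, z, rfl⟩ := tmk_surj t
    refine tmk_eq_iff.2 ⟨1, ?_, by simp [← Prod.one_eq_mk]⟩
    rw [smul_tmk, smul_tmk]
    exact tmk_eq_iff.2 ⟨1, by simp [smul_smul], by simp [smul_smul]⟩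

theorem regular_tensor [Finite G] (Y : Biset G K) : Iso (tensor (regular G) Y) Y := by
  refine tensor_iso (fun (x : G) y => ((x, 1) : G × K) • y) ?_ ?_ ?_
  · intro x y x' y'
    change G at x x'
    constructor
    · intro h
      refine ⟨x'⁻¹ * x, ?_, ?_⟩
      · change x' = (1 : G) * x * (x'⁻¹ * x)⁻¹
        simp
      · have : ((x'⁻¹ * x, 1) : G × K) = ((x', 1) : G × K)⁻¹ * (x, 1) := by simp
        rw [this, mul_smul, h, inv_smul_smul]
    · rintro ⟨h, h1, rfl⟩
      replace h1 : x' = (1 : G) * x * h⁻¹ := h1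
      simp [h1, smul_smul]
  · intro z
    exact ⟨(1 : G), z, one_smul (G × K) z⟩
  · intro a x y
    change G at x
    change ((a.1 * x * (1 : G)⁻¹, 1) : G × K) • ((1, a.2) : G × K) • y = a • ((x, 1) : G × K) • y
    simp only [smul_smul]
    congr 1
    ext <;> simp

theorem tensor_regular [Finite H] (X : Biset G H) : Iso (tensor X (regular H)) X := by
  refine tensor_iso (fun x (y : H) => ((1, y⁻¹) : G × H) • x) ?_ ?_ ?_
  · intro x y x' y'
    change H at y y'
    constructor
    · intro h
      refine ⟨y' * y⁻¹, ?_, ?_⟩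
      · have : ((1, y' * y⁻¹) : G × H) = ((1, y'⁻¹) : G × H)⁻¹ * (1, y⁻¹) := by simp
        rw [this, mul_smul, h, inv_smul_smul]
      · change y' = (y' * y⁻¹) * y * (1 : H)⁻¹
        simp
    · rintro ⟨h, rfl, h1⟩
      replace h1 : y' = h * y * (1 : H)⁻¹ := h1
      simp [h1, smul_smul]
  · intro z
    exact ⟨z, (1 : H), by simp [← Prod.one_eq_mk]⟩
  · intro a x y
    change H at y
    change ((1, ((1 : H) * y * a.2⁻¹)⁻¹) : G × H) • ((a.1, 1) : G × H) • x =
      a • ((1, y⁻¹) : G × H) • x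
    simp only [smul_smul]
    congr 1
    ext <;> simp

theorem sum_congr {X X' Y Y' : Biset G H} (hX : Iso X X') (hY : Iso Y Y') :
    Iso (sum X Y) (sum X' Y') := by
  obtain ⟨e, he⟩ := hX
  obtain ⟨f, hf⟩ := hY
  refine ⟨Equiv.sumCongr e f, ?_⟩
  rintro a (x | x)
  · exact congrArg Sum.inl (he a x)
  · exact congrArg Sum.inr (hf a x)

theorem sum_comm (X Y : Biset G H) : Iso (sum X Y) (sum Y X) := by
  refine ⟨Equiv.sumComm _ _, ?_⟩
  rintro a (x | x) <;> rfl

theorem sum_assoc (X Y Z : Biset G H) : Iso (sum (sum X Y) Z) (sum X (sum Y Z)) := by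
  refine ⟨Equiv.sumAssoc _ _ _, ?_⟩
  rintro a ((x | x) | x) <;> rfl

theorem empty_sum (X : Biset G H) : Iso (sum (empty G H) X) X := by
  refine ⟨Equiv.emptySum PEmpty _, ?_⟩
  rintro a (x | x)
  · exact x.elim
  · rfl

theorem sum_tensor (X X' : Biset G H) (Y : Biset H K) :
    Iso (tensor (sum X X') Y) (sum (tensor X Y) (tensor X' Y)) := by
  refine tensor_iso (fun (s : X.carrier ⊕ X'.carrier) y =>
    (Sum.map (fun x => tmk X Y x y) (fun x => tmk X' Y x y) s :
      (tensor X Y).carrier ⊕ (tensor X' Y).carrier)) ?_ ?_ ?_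
  · rintro (x | x) y (x' | x') y'
    · simp only [Sum.map_inl]
      refine Sum.inl_injective.eq_iff.trans (tmk_eq_iff.trans ?_)
      exact exists_congr fun h => and_congr_left fun _ => Sum.inl_injective.eq_iff.symm
    · refine iff_of_false (by simp) ?_
      rintro ⟨h, h1, -⟩
      exact Sum.inr_ne_inl h1
    · refine iff_of_false (by simp) ?_
      rintro ⟨h, h1, -⟩
      exact Sum.inl_ne_inr h1
    · simp only [Sum.map_inr]
      refine Sum.inr_injective.eq_iff.trans (tmk_eq_iff.trans ?_)
      exact exists_congr fun h => and_congr_left fun _ => Sum.inr_injective.eq_iff.symm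
  · rintro (t | t)
    · obtain ⟨x, y, rfl⟩ := tmk_surj t
      exact ⟨Sum.inl x, y, rfl⟩
    · obtain ⟨x, y, rfl⟩ := tmk_surj t
      exact ⟨Sum.inr x, y, rfl⟩
  · rintro a (x | x) y <;> rfl

theorem tensor_sum (X : Biset G H) (Y Y' : Biset H K) :
    Iso (tensor X (sum Y Y')) (sum (tensor X Y) (tensor X Y')) := by
  refine tensor_iso (fun x (s : Y.carrier ⊕ Y'.carrier) =>
    (Sum.map (fun y => tmk X Y x y) (fun y => tmk X Y' x y) s :
      (tensor X Y).carrier ⊕ (tensor X Y').carrier)) ?_ ?_ ?_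
  · rintro x (y | y) x' (y' | y')
    · simp only [Sum.map_inl]
      refine Sum.inl_injective.eq_iff.trans (tmk_eq_iff.trans ?_)
      exact exists_congr fun h => and_congr_right fun _ => Sum.inl_injective.eq_iff.symm
    · refine iff_of_false (by simp) ?_
      rintro ⟨h, -, h1⟩
      exact Sum.inr_ne_inl h1
    · refine iff_of_false (by simp) ?_
      rintro ⟨h, -, h1⟩
      exact Sum.inl_ne_inr h1
    · simp only [Sum.map_inr]
      refine Sum.inr_injective.eq_iff.trans (tmk_eq_iff.trans ?_)
      exact exists_congr fun h => and_congr_right fun _ => Sum.inr_injective.eq_iff.symm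
  · rintro (t | t)
    · obtain ⟨x, y, rfl⟩ := tmk_surj t
      exact ⟨x, Sum.inl y, rfl⟩
    · obtain ⟨x, y, rfl⟩ := tmk_surj t
      exact ⟨x, Sum.inr y, rfl⟩
  · rintro a x (y | y) <;> rfl

theorem empty_tensor (Y : Biset H K) : Iso (tensor (empty G H) Y) (empty G K) :=
  tensor_iso (fun x _ => x) (fun x => x.elim) (fun z => z.elim) (fun _ x => x.elim)

theorem tensor_empty (X : Biset G H) : Iso (tensor X (empty H K)) (empty G K) :=
  tensor_iso (fun _ y => y) (fun _ y => y.elim) (fun z => z.elim) (fun _ _ y => y.elim)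

/-- The fixed points of a subgroup `L` of `G × H` on a biset. -/
def fixedSet (X : Biset G H) (L : Subgroup (G × H)) : Set X.carrier :=
  {x | ∀ a ∈ L, a • x = x}

/-- The restriction of a biset to an invariant subset. -/
def subBiset (X : Biset G H) (A : Set X.carrier) (hA : ∀ (a : G × H), ∀ x ∈ A, a • x ∈ A) :
    Biset G H where
  carrier := A
  action :=
    { smul := fun a x => ⟨a • x.1, hA a x.1 x.2⟩
      one_smul := fun x => Subtype.ext (one_smul _ x.1)
      mul_smul := fun a b x => Subtype.ext (mul_smul a b x.1) }

theorem iso_sum_compl (X : Biset G H) (A : Set X.carrier)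
    (hA : ∀ (a : G × H), ∀ x ∈ A, a • x ∈ A) (hA' : ∀ (a : G × H), ∀ x ∈ Aᶜ, a • x ∈ Aᶜ) :
    Iso (sum (subBiset X A hA) (subBiset X Aᶜ hA')) X := by
  classical
  refine ⟨Equiv.Set.sumCompl A, ?_⟩
  rintro a (x | x) <;> rfl

theorem coset_iso_orbit (X : Biset G H) [Finite G] [Finite H] (x : X.carrier)
    (hA : ∀ (a : G × H), ∀ y ∈ MulAction.orbit (G × H) x, a • y ∈ MulAction.orbit (G × H) x) :
    Iso (coset (MulAction.stabilizer (G × H) x)) (subBiset X (MulAction.orbit (G × H) x) hA) := by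
  refine ⟨(MulAction.orbitEquivQuotientStabilizer (G × H) x).symm, ?_⟩
  rintro a ⟨b⟩
  exact Subtype.ext (mul_smul a b x)

end Biset

/-- Isomorphism classes of `(G, H)`-bisets. -/
def BisetClass (G H : Type u) [Group G] [Group H] : Type (u + 1) :=
  Quotient (Biset.isoSetoid G H)

namespace BisetClass

variable {G H K : Type u} [Group G] [Group H] [Group K]

/-- The isomorphism class of a biset. -/
def mk (X : Biset G H) : BisetClass G H := Quotient.mk _ X

theorem mk_eq {X Y : Biset G H} (h : Biset.Iso X Y) : mk X = mk Y := Quotient.sound h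

instance : Zero (BisetClass G H) := ⟨mk (Biset.empty G H)⟩

/-- Addition of isomorphism classes is disjoint union. -/
instance : Add (BisetClass G H) :=
  ⟨Quotient.map₂ Biset.sum fun _ _ h _ _ h' => Biset.sum_congr h h'⟩

instance : AddCommMonoid (BisetClass G H) where
  add_assoc := by
    rintro ⟨X⟩ ⟨Y⟩ ⟨Z⟩
    exact mk_eq (Biset.sum_assoc X Y Z)
  zero_add := by
    rintro ⟨X⟩
    exact mk_eq (Biset.empty_sum X)
  add_zero := by
    rintro ⟨X⟩
    exact mk_eq ((Biset.sum_comm _ _).trans (Biset.empty_sum X))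
  add_comm := by
    rintro ⟨X⟩ ⟨Y⟩
    exact mk_eq (Biset.sum_comm X Y)
  nsmul := nsmulRec

theorem mk_sum (X Y : Biset G H) : mk (X.sum Y) = mk X + mk Y := rfl

theorem mk_empty : mk (Biset.empty G H) = 0 := rfl

/-- The tensor product on isomorphism classes. -/
def tensor : BisetClass G H → BisetClass H K → BisetClass G K :=
  Quotient.map₂ Biset.tensor fun _ _ h _ _ h' => Biset.tensor_congr h h'

/-- The tensor product on isomorphism classes, as a biadditive map. -/
def tensorHom : BisetClass G H →+ BisetClass H K →+ BisetClass G K where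
  toFun a :=
    { toFun := tensor a
      map_zero' := by
        obtain ⟨X⟩ := a
        exact mk_eq (Biset.tensor_empty X)
      map_add' := by
        obtain ⟨X⟩ := a
        rintro ⟨Y⟩ ⟨Y'⟩
        exact mk_eq (Biset.tensor_sum X Y Y') }
  map_zero' := by
    ext ⟨Y⟩
    exact mk_eq (Biset.empty_tensor Y)
  map_add' := by
    rintro ⟨X⟩ ⟨X'⟩
    ext ⟨Y⟩
    exact mk_eq (Biset.sum_tensor X X' Y)

theorem tensorHom_mk (X : Biset G H) (Y : Biset H K) :
    tensorHom (mk X) (mk Y) = mk (X.tensor Y) := rfl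

/-- The number of fixed points of `L`, on isomorphism classes of bisets. -/
noncomputable def card (L : Subgroup (G × H)) : BisetClass G H →+ ℤ where
  toFun := Quotient.lift (fun X : Biset G H => (Nat.card (X.fixedSet L) : ℤ)) (by
    rintro X Y ⟨e, he⟩
    refine congrArg Nat.cast (Nat.card_congr (e.subtypeEquiv fun x => ?_))
    simp only [Biset.fixedSet, Set.mem_ofPred_eq, ← he, e.injective.eq_iff])
  map_zero' := by
    change ((Nat.card _ : ℕ) : ℤ) = 0
    have : IsEmpty ((Biset.empty G H).fixedSet L) := ⟨fun x => x.1.elim⟩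
    simp
  map_add' := by
    rintro ⟨X⟩ ⟨Y⟩
    change ((Nat.card ((X.sum Y).fixedSet L) : ℕ) : ℤ) =
      (Nat.card (X.fixedSet L) : ℕ) + (Nat.card (Y.fixedSet L) : ℕ)
    have e : (X.sum Y).fixedSet L ≃ X.fixedSet L ⊕ Y.fixedSet L :=
      (Equiv.subtypeSum (p := fun x => x ∈ (X.sum Y).fixedSet L)).trans
        (Equiv.sumCongr
          (Equiv.subtypeEquivRight fun x =>
            forall₂_congr fun a _ => Sum.inl_injective.eq_iff (a := a • x) (b := x))
          (Equiv.subtypeEquivRight fun x =>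
            forall₂_congr fun a _ => Sum.inr_injective.eq_iff (a := a • x) (b := x)))
    rw [Nat.card_congr e, Nat.card_sum]
    push_cast
    rfl

end BisetClass

/-- The double Burnside group `B(G, H)`: the Grothendieck group of `(G, H)`-bisets with respect to
disjoint unions. -/
def DoubleBurnside (G H : Type u) [Group G] [Group H] : Type (u + 1) :=
  Algebra.GrothendieckAddGroup (BisetClass G H)

namespace DoubleBurnside

variable {G H K L : Type u} [Group G] [Group H] [Group K] [Group L]

noncomputable instance : AddCommGroup (DoubleBurnside G H) :=
  inferInstanceAs (AddCommGroup (Algebra.GrothendieckAddGroup (BisetClass G H)))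

/-- The canonical map from isomorphism classes of bisets to the double Burnside group. -/
noncomputable def of : BisetClass G H →+ DoubleBurnside G H :=
  Algebra.GrothendieckAddGroup.of

/-- The class `[X]` of a biset in the double Burnside group. -/
noncomputable def cls (X : Biset G H) : DoubleBurnside G H := of (BisetClass.mk X)

theorem cls_eq {X Y : Biset G H} (h : Biset.Iso X Y) : cls X = cls Y :=
  congrArg of (BisetClass.mk_eq h)

theorem cls_sum (X Y : Biset G H) : cls (X.sum Y) = cls X + cls Y := by
  rw [cls, BisetClass.mk_sum, map_add]; rfl

/-- The universal property of the Grothendieck group. -/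
noncomputable def lift {A : Type w} [AddCommGroup A] :
    (BisetClass G H →+ A) ≃ (DoubleBurnside G H →+ A) :=
  Algebra.GrothendieckAddGroup.lift

theorem lift_of {A : Type w} [AddCommGroup A] (f : BisetClass G H →+ A) (a : BisetClass G H) :
    lift f (of a) = f a :=
  DFunLike.congr_fun (lift.symm_apply_apply f) a

theorem lift_cls {A : Type w} [AddCommGroup A] (f : BisetClass G H →+ A) (X : Biset G H) :
    lift f (cls X) = f (BisetClass.mk X) := lift_of f _

theorem hom_ext {A : Type w} [AddCommGroup A] {f g : DoubleBurnside G H →+ A}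
    (h : ∀ X, f (cls X) = g (cls X)) : f = g := by
  refine lift.symm.injective (AddMonoidHom.ext ?_)
  rintro ⟨X⟩
  exact h X

/-- The bilinear map `B(G, H) × B(H, K) → B(G, K)` induced by the tensor product of bisets. -/
noncomputable def tensor :
    DoubleBurnside G H →+ DoubleBurnside H K →+ DoubleBurnside G K :=
  lift
    { toFun := fun a => lift (of.comp (BisetClass.tensorHom a))
      map_zero' := hom_ext fun X => by rw [lift_cls]; simp
      map_add' := fun a b => hom_ext fun X => by
        rw [AddMonoidHom.add_apply, lift_cls, lift_cls, lift_cls]; simp }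

theorem tensor_cls (X : Biset G H) (Y : Biset H K) :
    tensor (cls X) (cls Y) = cls (X.tensor Y) := by
  rw [tensor, lift_cls]
  exact lift_cls _ _

theorem cls_induction {p : DoubleBurnside G H → Prop} (hc : ∀ X, p (cls X)) (h0 : p 0)
    (ha : ∀ a b, p a → p b → p (a + b)) (hn : ∀ a, p a → p (-a)) (a : DoubleBurnside G H) :
    p a := by
  let S := AddSubgroup.closure (Set.range (cls (G := G) (H := H)))
  have h : QuotientAddGroup.mk' S = 0 := hom_ext fun X =>
    (QuotientAddGroup.eq_zero_iff _).2 (AddSubgroup.subset_closure ⟨X, rfl⟩)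
  have hS : a ∈ S := (QuotientAddGroup.eq_zero_iff _).1 (DFunLike.congr_fun h a)
  refine AddSubgroup.closure_induction (p := fun x _ => p x) ?_ h0 (fun x y _ _ => ha x y)
    (fun x _ => hn x) hS
  rintro _ ⟨X, rfl⟩
  exact hc X

theorem tensor_assoc (a : DoubleBurnside G H) (b : DoubleBurnside H K) (c : DoubleBurnside K L) :
    tensor (tensor a b) c = tensor a (tensor b c) := by
  induction a using cls_induction with
  | h0 => simp
  | ha x y hx hy => simp [hx, hy]
  | hn x hx => simp [hx]
  | hc X =>
    induction b using cls_induction with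
    | h0 => simp
    | ha x y hx hy => simp [hx, hy]
    | hn x hx => simp [hx]
    | hc Y =>
      induction c using cls_induction with
      | h0 => simp
      | ha x y hx hy => simp [hx, hy]
      | hn x hx => simp [hx]
      | hc Z =>
        simp only [tensor_cls]
        exact cls_eq (Biset.tensor_assoc X Y Z)

theorem one_tensor [Finite G] (a : DoubleBurnside G K) :
    tensor (cls (Biset.regular G)) a = a := by
  induction a using cls_induction with
  | h0 => simp
  | ha x y hx hy => simp [hx, hy]
  | hn x hx => simp [hx]
  | hc X => rw [tensor_cls, cls_eq (Biset.regular_tensor X)]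

theorem tensor_one [Finite H] (a : DoubleBurnside G H) :
    tensor a (cls (Biset.regular H)) = a := by
  induction a using cls_induction with
  | h0 => simp
  | ha x y hx hy => simp [hx, hy]
  | hn x hx => simp [hx]
  | hc X => rw [tensor_cls, cls_eq (Biset.tensor_regular X)]

/-- The double Burnside ring `B(G, G)`. -/
noncomputable instance [Finite G] : Ring (DoubleBurnside G G) where
  __ := (inferInstance : AddCommGroup (DoubleBurnside G G))
  mul a b := tensor a b
  one := cls (Biset.regular G)
  mul_assoc := tensor_assoc
  one_mul := one_tensor
  mul_one := tensor_one
  left_distrib a := map_add (tensor a)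
  right_distrib a b c := by
    change tensor (a + b) c = tensor a c + tensor b c
    simp
  zero_mul a := by
    change tensor 0 a = 0
    simp
  mul_zero a := map_zero (tensor a)

theorem mul_def [Finite G] (a b : DoubleBurnside G G) : a * b = tensor a b := rfl

theorem one_def [Finite G] : (1 : DoubleBurnside G G) = cls (Biset.regular G) := rfl

/-- The homomorphism `Φ_L : B(G, H) → ℤ`, `[X] ↦ |X^L|`. -/
noncomputable def mark (L : Subgroup (G × H)) : DoubleBurnside G H →+ ℤ :=
  lift (BisetClass.card L)

theorem mark_cls (L : Subgroup (G × H)) (X : Biset G H) :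
    mark L (cls X) = Nat.card (X.fixedSet L) := lift_cls _ X

/-- `B^T(G, H)`: the subgroup of `B(G, H)` spanned by the `[(G × H) / L]` with `L ∈ T`. -/
noncomputable def restricted [Finite G] [Finite H] (T : Set (Subgroup (G × H))) :
    AddSubgroup (DoubleBurnside G H) :=
  AddSubgroup.closure ((fun L => cls (Biset.coset L)) '' T)

/-- The class of a biset all of whose point stabilizers lie in `T` lies in `B^T(G, H)`. -/
theorem cls_mem_restricted [Finite G] [Finite H] {T : Set (Subgroup (G × H))} (X : Biset G H)
    (hX : ∀ x : X.carrier, MulAction.stabilizer (G × H) x ∈ T) : cls X ∈ restricted T := by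
  induction hn : Nat.card X.carrier using Nat.strong_induction_on generalizing X with
  | _ n ih =>
    rcases isEmpty_or_nonempty X.carrier with h | ⟨⟨x⟩⟩
    · have : Biset.Iso X (Biset.empty G H) :=
        ⟨Equiv.equivPEmpty _, fun _ x => isEmptyElim x⟩
      rw [cls_eq this, cls, BisetClass.mk_empty, map_zero]
      exact zero_mem _
    · have hA : ∀ (a : G × H), ∀ y ∈ MulAction.orbit (G × H) x,
          a • y ∈ MulAction.orbit (G × H) x := fun a y hy =>
        MulAction.mem_orbit_of_mem_orbit a hy
      have hA' : ∀ (a : G × H), ∀ y ∈ (MulAction.orbit (G × H) x)ᶜ,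
          a • y ∈ (MulAction.orbit (G × H) x)ᶜ := fun a y hy h =>
        hy (by simpa using MulAction.mem_orbit_of_mem_orbit a⁻¹ h)
      rw [← cls_eq (Biset.iso_sum_compl X _ hA hA'), cls_sum,
        ← cls_eq (Biset.coset_iso_orbit X x hA)]
      refine add_mem (AddSubgroup.subset_closure ⟨_, hX x, rfl⟩) (ih _ ?_ _ ?_ rfl)
      · rw [← hn]
        exact Finite.card_subtype_lt (x := x) (fun h => h (MulAction.mem_orbit_self x))
      · intro y
        have : MulAction.stabilizer (G × H) y = MulAction.stabilizer (G × H) y.1 := by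
          ext a
          exact Subtype.ext_iff
        rw [this]
        exact hX _

end DoubleBurnside

/-- `R B(G, H) = R ⊗ B(G, H)`. For `H = G` this is an `R`-algebra by base change of the ring
`B(G, G)`. -/
abbrev ScalarBurnside (R : Type w) [CommRing R] (G H : Type u) [Group G] [Group H] :
    Type (max w (u + 1)) :=
  R ⊗[ℤ] DoubleBurnside G H

namespace ScalarBurnside

open DoubleBurnside

variable (R : Type w) [CommRing R] {G H K : Type u} [Group G] [Group H] [Group K]

/-- The `R`-bilinear extension of the tensor product of bisets. -/
noncomputable def tensor :
    ScalarBurnside R G H →ₗ[R] ScalarBurnside R H K →ₗ[R] ScalarBurnside R G K :=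
  TensorProduct.AlgebraTensorModule.lift
    { toFun := fun r =>
        { toFun := fun b => r • LinearMap.baseChange R (DoubleBurnside.tensor b).toIntLinearMap
          map_add' := fun b c => by ext; simp [TensorProduct.tmul_add]
          map_smul' := fun n b => by ext; simp [smul_comm r n] }
      map_add' := fun r s => by ext; simp [add_smul]
      map_smul' := fun r s => by ext; simp [mul_smul] }

theorem tensor_tmul (r s : R) (a : DoubleBurnside G H) (b : DoubleBurnside H K) :
    tensor R (r ⊗ₜ a) (s ⊗ₜ b) = (r * s) ⊗ₜ DoubleBurnside.tensor a b := by
  simp [tensor, TensorProduct.smul_tmul']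

theorem mul_eq_tensor [Finite G] (a b : ScalarBurnside R G G) : a * b = tensor R a b := by
  induction a using TensorProduct.induction_on with
  | zero => simp
  | add x y hx hy => rw [add_mul, hx, hy, map_add, LinearMap.add_apply]
  | tmul r x =>
    induction b using TensorProduct.induction_on with
    | zero => simp
    | add y z hy hz => rw [mul_add, hy, hz, map_add]
    | tmul s y => rw [tensor_tmul, Algebra.TensorProduct.tmul_mul_tmul, mul_def]

/-- The `R`-linear extension of `Φ_L`. -/
noncomputable def mark (L : Subgroup (G × H)) : ScalarBurnside R G H →ₗ[R] R :=
  (TensorProduct.AlgebraTensorModule.rid ℤ R R).toLinearMap ∘ₗ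
    LinearMap.baseChange R (DoubleBurnside.mark L).toIntLinearMap

theorem mark_tmul (L : Subgroup (G × H)) (r : R) (a : DoubleBurnside G H) :
    mark R L (r ⊗ₜ a) = r * (DoubleBurnside.mark L a : R) := by
  simp [mark, mul_comm]

/-- For a subgroup `A` of `B(G, H)`, the `R`-submodule of `R B(G, H)` generated by `A`. -/
noncomputable def extend (A : AddSubgroup (DoubleBurnside G H)) : Submodule R (ScalarBurnside R G H) :=
  Submodule.span R ((fun a => (1 : R) ⊗ₜ[ℤ] a) '' (A : Set (DoubleBurnside G H)))

end ScalarBurnside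

section Subgroups

variable {G H K : Type u} [Group G] [Group H] [Group K]

/-- `k₁(L) = {g | (g, 1) ∈ L}`. -/
def kOne (L : Subgroup (G × H)) : Subgroup G := L.comap (MonoidHom.inl G H)

/-- `k₂(L) = {h | (1, h) ∈ L}`. -/
def kTwo (L : Subgroup (G × H)) : Subgroup H := L.comap (MonoidHom.inr G H)

/-- The subgroups `L` of `G × H` with `k₁(L) = 1`. -/
def leftFreeSubgroups (G H : Type u) [Group G] [Group H] : Set (Subgroup (G × H)) :=
  {L | kOne L = ⊥}

/-- The opposite subgroup. -/
def opSubgroup (L : Subgroup (G × H)) : Subgroup (H × G) :=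
  L.comap (MulEquiv.prodComm : H × G ≃* G × H).toMonoidHom

/-- The product `L * M`: composition of relations. -/
def starSubgroup (L : Subgroup (G × H)) (M : Subgroup (H × K)) : Subgroup (G × K) where
  carrier := {a | ∃ h, (a.1, h) ∈ L ∧ (h, a.2) ∈ M}
  one_mem' := ⟨1, L.one_mem, M.one_mem⟩
  mul_mem' := by
    rintro a b ⟨h, h1, h2⟩ ⟨k, k1, k2⟩
    exact ⟨h * k, L.mul_mem h1 k1, M.mul_mem h2 k2⟩
  inv_mem' := by
    rintro a ⟨h, h1, h2⟩
    exact ⟨h⁻¹, L.inv_mem h1, M.inv_mem h2⟩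

/-- The diagonal subgroup `Δ(G)`. -/
def diagSubgroup (G : Type u) [Group G] : Subgroup (G × G) :=
  ((MonoidHom.id G).prod (MonoidHom.id G)).range

/-- Triples `(U, α, V)` with `U ≤ G`, `V ≤ H` and an epimorphism `α : V → U`. -/
structure EpiTriple (G H : Type u) [Group G] [Group H] where
  U : Subgroup G
  V : Subgroup H
  α : V →* U
  surj : Function.Surjective α

/-- The subgroup `{(α(h), h) | h ∈ V}` of `G × H`. -/
def EpiTriple.toSubgroup (t : EpiTriple G H) : Subgroup (G × H) :=
  ((t.U.subtype.comp t.α).prod t.V.subtype).range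

/-- The twisted diagonal subgroups of `G × H`. -/
def twistedDiagonals (G H : Type u) [Group G] [Group H] : Set (Subgroup (G × H)) :=
  {L | ∃ t : EpiTriple G H, Function.Bijective t.α ∧ t.toSubgroup = L}

theorem mem_twistedDiagonals_iff {L : Subgroup (G × H)} :
    L ∈ twistedDiagonals G H ↔ kOne L = ⊥ ∧ kTwo L = ⊥ := by
  constructor
  · rintro ⟨t, ht, rfl⟩
    constructor
    · refine (Subgroup.eq_bot_iff_forall _).2 ?_
      rintro g ⟨v, hv⟩
      obtain ⟨h1, h2⟩ := Prod.ext_iff.1 hv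
      have : v = 1 := Subtype.ext h2
      subst this
      simpa using h1.symm
    · refine (Subgroup.eq_bot_iff_forall _).2 ?_
      rintro g ⟨v, hv⟩
      obtain ⟨h1, h2⟩ := Prod.ext_iff.1 hv
      have h3 : t.α v = 1 := Subtype.ext h1
      have : v = 1 := ht.1 (by rw [h3, map_one])
      subst this
      simpa using h2.symm
  · rintro ⟨h1, h2⟩
    have i1 : Function.Injective ((MonoidHom.fst G H).comp L.subtype) := by
      rw [injective_iff_map_eq_one]
      rintro ⟨⟨g, h⟩, hL⟩ (rfl : g = 1)
      have : h ∈ kTwo L := hL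
      rw [h2, Subgroup.mem_bot] at this
      subst this
      rfl
    have i2 : Function.Injective ((MonoidHom.snd G H).comp L.subtype) := by
      rw [injective_iff_map_eq_one]
      rintro ⟨⟨g, h⟩, hL⟩ (rfl : h = 1)
      have : g ∈ kOne L := hL
      rw [h1, Subgroup.mem_bot] at this
      subst this
      rfl
    let e := (MonoidHom.ofInjective i2).symm.trans (MonoidHom.ofInjective i1)
    refine ⟨⟨_, _, e.toMonoidHom, e.surjective⟩, e.bijective, ?_⟩
    have key : ∀ x : L, ((e (MonoidHom.ofInjective i2 x)) : G) = (x : G × H).1 := fun x => by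
      simp only [e, MulEquiv.trans_apply, MulEquiv.symm_apply_apply]
      rfl
    ext ⟨g, h⟩
    constructor
    · rintro ⟨v, hv⟩
      obtain ⟨x, rfl⟩ := (MonoidHom.ofInjective i2).surjective v
      have : (x : G × H) = (g, h) := by
        rw [← hv]
        exact Prod.ext (key x).symm rfl
      rw [← this]
      exact x.2
    · intro hL
      exact ⟨MonoidHom.ofInjective i2 ⟨(g, h), hL⟩, Prod.ext (key ⟨(g, h), hL⟩) rfl⟩

end Subgroups

/-- `HasCompositionSeries G n`: the group `G` has a composition series with `n` factors. -/
inductive HasCompositionSeries : (G : Type u) → [Group G] → ℕ → Prop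
  | trivial (G : Type u) [Group G] [Subsingleton G] : HasCompositionSeries G 0
  | step (G : Type u) [Group G] (N : Subgroup G) [N.Normal] (n : ℕ) :
      IsSimpleGroup (G ⧸ N) → HasCompositionSeries N n → HasCompositionSeries G (n + 1)

/-- The composition length of a finite group. -/
noncomputable def compositionLength (G : Type u) [Group G] : ℕ :=
  sInf {n | HasCompositionSeries G n}

/-- A class of finite groups `Γ i` together with, for any two of them, a set of subgroups of
`Γ i × Γ j`, closed under conjugation, passing to subgroups and composition, and containing the
diagonal subgroups. -/
structure BisetSystem {ι : Type v} (Γ : ι → Type u) [∀ i, Group (Γ i)] where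
  sub : ∀ i j, Set (Subgroup (Γ i × Γ j))
  conj_mem : ∀ {i j} {L : Subgroup (Γ i × Γ j)}, L ∈ sub i j → ∀ a : Γ i × Γ j,
    L.map (MulAut.conj a).toMonoidHom ∈ sub i j
  le_mem : ∀ {i j} {L M : Subgroup (Γ i × Γ j)}, L ∈ sub i j → M ≤ L → M ∈ sub i j
  star_mem : ∀ {i j k} {L : Subgroup (Γ i × Γ j)} {M : Subgroup (Γ j × Γ k)},
    L ∈ sub i j → M ∈ sub j k → starSubgroup L M ∈ sub i k
  diag_mem : ∀ i, diagSubgroup (Γ i) ∈ sub i i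

namespace BisetSystem

variable {ι : Type v} {Γ : ι → Type u} [∀ i, Group (Γ i)]

/-- The subsystem `Δ(S)` of the twisted diagonal subgroups in `S`. -/
def bifree (S : BisetSystem Γ) : BisetSystem Γ where
  sub i j := S.sub i j ∩ twistedDiagonals (Γ i) (Γ j)
  conj_mem := by
    rintro i j L ⟨hL, hT⟩ a
    refine ⟨S.conj_mem hL a, ?_⟩
    rw [mem_twistedDiagonals_iff, Subgroup.eq_bot_iff_forall, Subgroup.eq_bot_iff_forall] at hT ⊢
    constructor
    · rintro g ⟨⟨x, y⟩, hx, h⟩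
      obtain ⟨h1, h2⟩ := Prod.ext_iff.1 h
      simp only [MulEquiv.coe_toMonoidHom, MulAut.conj_apply, MonoidHom.inl_apply, Prod.fst_mul,
        Prod.snd_mul, Prod.fst_inv, Prod.snd_inv, conj_eq_one_iff] at h1 h2
      subst h2
      have := hT.1 x hx
      rw [← h1, this]
      simp
    · rintro g ⟨⟨x, y⟩, hx, h⟩
      obtain ⟨h1, h2⟩ := Prod.ext_iff.1 h
      simp only [MulEquiv.coe_toMonoidHom, MulAut.conj_apply, MonoidHom.inr_apply, Prod.fst_mul,
        Prod.snd_mul, Prod.fst_inv, Prod.snd_inv, conj_eq_one_iff] at h1 h2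
      subst h1
      have := hT.2 y hx
      rw [← h2, this]
      simp
  le_mem := by
    rintro i j L M ⟨hL, hT⟩ hM
    refine ⟨S.le_mem hL hM, ?_⟩
    rw [mem_twistedDiagonals_iff] at hT ⊢
    exact ⟨le_bot_iff.1 (hT.1 ▸ Subgroup.comap_mono hM),
      le_bot_iff.1 (hT.2 ▸ Subgroup.comap_mono hM)⟩
  star_mem := by
    rintro i j k L M ⟨hL, hLT⟩ ⟨hM, hMT⟩
    refine ⟨S.star_mem hL hM, ?_⟩
    rw [mem_twistedDiagonals_iff, Subgroup.eq_bot_iff_forall, Subgroup.eq_bot_iff_forall]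
      at hLT hMT ⊢
    constructor
    · rintro g ⟨h, h1, h2⟩
      obtain rfl := hMT.1 h h2
      exact hLT.1 g h1
    · rintro g ⟨h, h1, h2⟩
      obtain rfl := hLT.2 h h1
      exact hMT.2 g h2
  diag_mem i := by
    refine ⟨S.diag_mem i, ?_⟩
    rw [mem_twistedDiagonals_iff, Subgroup.eq_bot_iff_forall, Subgroup.eq_bot_iff_forall]
    constructor
    · rintro g ⟨x, hx⟩
      obtain ⟨h1, h2⟩ := Prod.ext_iff.1 hx
      exact h1.symm.trans h2
    · rintro g ⟨x, hx⟩
      obtain ⟨h1, h2⟩ := Prod.ext_iff.1 hx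
      exact h2.symm.trans h1

/-- `Aut_{S_G}(U)` for `G = Γ i` and `U ≤ G`: the automorphisms `φ` of `U` such that
`{(φ(u), u) | u ∈ U}` belongs to the system. -/
def autSubgroup [∀ i, Finite (Γ i)] (S : BisetSystem Γ) (i : ι) (U : Subgroup (Γ i)) :
    Subgroup (MulAut U) :=
  let M : Submonoid (MulAut U) :=
    { carrier := {φ | (EpiTriple.mk U U φ.toMonoidHom φ.surjective).toSubgroup ∈ S.sub i i}
      one_mem' := by
        refine S.le_mem (S.diag_mem i) ?_
        rintro _ ⟨u, rfl⟩
        exact ⟨u, rfl⟩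
      mul_mem' := by
        intro φ ψ hφ hψ
        refine S.le_mem (S.star_mem hφ hψ) ?_
        rintro _ ⟨u, rfl⟩
        exact ⟨ψ u, ⟨ψ u, rfl⟩, ⟨u, rfl⟩⟩ }
  { M with
    inv_mem' := by
      intro φ hφ
      have : Finite (MulAut U) := Finite.of_injective (fun φ : MulAut U => (φ : U → U))
        DFunLike.coe_injective
      obtain ⟨n, hn⟩ : φ⁻¹ ∈ Submonoid.powers φ :=
        mem_powers_iff_mem_zpowers.2 (Subgroup.inv_mem _ (Subgroup.mem_zpowers φ))
      have : φ⁻¹ ∈ M := by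
        rw [← hn]
        exact M.pow_mem hφ n
      exact this }

theorem conj_mem_autSubgroup [∀ i, Finite (Γ i)] (S : BisetSystem Γ) (i : ι)
    (U : Subgroup (Γ i)) : (MulAut.conj : U →* MulAut U).range ≤ S.autSubgroup i U := by
  rintro _ ⟨u, rfl⟩
  refine S.le_mem (S.conj_mem (S.diag_mem i) (u, 1)) ?_
  rintro _ ⟨v, rfl⟩
  refine ⟨(v, v), ⟨v, rfl⟩, ?_⟩
  ext <;> simp

/-- `Out_{S_G}(U) = Aut_{S_G}(U) / Inn(U)` for `G = Γ i` and `U ≤ G`. -/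
abbrev Out [∀ i, Finite (Γ i)] (S : BisetSystem Γ) (i : ι) (U : Subgroup (Γ i)) : Type u :=
  S.autSubgroup i U ⧸ (MulAut.conj : U →* MulAut U).range.subgroupOf (S.autSubgroup i U)

open DoubleBurnside in
theorem tensor_mem_restricted [∀ i, Finite (Γ i)] (S : BisetSystem Γ) {i j k : ι}
    {a : DoubleBurnside (Γ i) (Γ j)} {b : DoubleBurnside (Γ j) (Γ k)}
    (ha : a ∈ restricted (S.sub i j)) (hb : b ∈ restricted (S.sub j k)) :
    tensor a b ∈ restricted (S.sub i k) := by
  have stab : ∀ {i j : ι} {L : Subgroup (Γ i × Γ j)}, L ∈ S.sub i j →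
      ∀ x : (Biset.coset L).carrier, MulAction.stabilizer (Γ i × Γ j) x ∈ S.sub i j := by
    rintro i j L hL ⟨g⟩
    refine S.le_mem (S.conj_mem hL g) ?_
    intro a ha
    have h1 : ((a * g : Γ i × Γ j) : (Γ i × Γ j) ⧸ L) = (g : (Γ i × Γ j) ⧸ L) := ha
    have h2 : g⁻¹ * (a * g) ∈ L := QuotientGroup.eq.1 h1.symm
    exact ⟨_, h2, by simp [mul_assoc]⟩
  induction ha using AddSubgroup.closure_induction with
  | zero => simp
  | add x y _ _ hx hy => simpa using add_mem hx hy
  | neg x _ hx => simpa using hx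
  | mem x hx =>
    obtain ⟨L, hL, rfl⟩ := hx
    induction hb using AddSubgroup.closure_induction with
    | zero => simp
    | add x y _ _ hx hy => simpa using add_mem hx hy
    | neg x _ hx => simpa using hx
    | mem y hy =>
      obtain ⟨M, hM, rfl⟩ := hy
      change tensor (cls (Biset.coset L)) (cls (Biset.coset M)) ∈ _
      rw [tensor_cls]
      refine cls_mem_restricted _ fun t => ?_
      obtain ⟨x, y, rfl⟩ := Biset.tmk_surj t
      refine S.le_mem (S.star_mem (stab hL x) (stab hM y)) ?_
      intro a ha
      have h := (MulAction.mem_stabilizer_iff.1 ha).symm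
      rw [Biset.smul_tmk, Biset.tmk_eq_iff] at h
      obtain ⟨h, h1, h2⟩ := h
      refine ⟨h⁻¹, ?_, ?_⟩
      · have e : ((a.1, h⁻¹) : Γ i × Γ j) = (1, h)⁻¹ * (a.1, 1) := by simp
        rw [MulAction.mem_stabilizer_iff, e, mul_smul, h1, inv_smul_smul]
      · have e : ((h⁻¹, a.2) : Γ j × Γ k) = (h, 1)⁻¹ * (1, a.2) := by simp
        rw [MulAction.mem_stabilizer_iff, e, mul_smul, h2, inv_smul_smul]

open DoubleBurnside in
theorem one_mem_restricted [∀ i, Finite (Γ i)] (S : BisetSystem Γ) (i : ι) :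
    (1 : DoubleBurnside (Γ i) (Γ i)) ∈ restricted (S.sub i i) := by
  rw [one_def]
  refine cls_mem_restricted _ fun x => ?_
  change Γ i at x
  refine S.le_mem (S.conj_mem (S.diag_mem i) (x, 1)) ?_
  intro a ha
  have h : a.1 * x * a.2⁻¹ = x := ha
  refine ⟨(a.2, a.2), ⟨a.2, rfl⟩, ?_⟩
  have h' : a.1 = x * a.2 * x⁻¹ := by
    rw [eq_mul_inv_iff_mul_eq, ← mul_inv_eq_iff_eq_mul, h]
  ext
  · simp [h']
  · simp

variable [∀ i, Finite (Γ i)] (R : Type w) [CommRing R] (S : BisetSystem Γ)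

/-- `R B^S(G, H)` for `G = Γ i`, `H = Γ j`. -/
noncomputable def burnside (i j : ι) : Submodule R (ScalarBurnside R (Γ i) (Γ j)) :=
  ScalarBurnside.extend R (DoubleBurnside.restricted (S.sub i j))

/-- `B^S_n(G, H)` for `G = Γ i`, `H = Γ j`: the elements of `B^S(G, H)` whose mark at
`{(α(h), h) | h ∈ V}` vanishes for all epimorphisms `α : V → U` with `l(ker α) ≠ n`. -/
noncomputable def intGraded (i j : ι) (n : ℕ) : AddSubgroup (DoubleBurnside (Γ i) (Γ j)) :=
  DoubleBurnside.restricted (S.sub i j) ⊓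
    ⨅ (t : EpiTriple (Γ i) (Γ j)) (_ : compositionLength t.α.ker ≠ n),
      (DoubleBurnside.mark t.toSubgroup).ker

theorem mem_intGraded {i j : ι} {n : ℕ} {a : DoubleBurnside (Γ i) (Γ j)} :
    a ∈ S.intGraded i j n ↔ a ∈ DoubleBurnside.restricted (S.sub i j) ∧
      ∀ t : EpiTriple (Γ i) (Γ j), compositionLength t.α.ker ≠ n →
        DoubleBurnside.mark t.toSubgroup a = 0 := by
  simp [intGraded, AddSubgroup.mem_inf, AddSubgroup.mem_iInf]

/-- `R B^S_n(G, H)` for `G = Γ i`, `H = Γ j`: the `R`-span of `B^S_n(G, H)`. -/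
noncomputable def graded (i j : ι) (n : ℕ) : Submodule R (ScalarBurnside R (Γ i) (Γ j)) :=
  ScalarBurnside.extend R (S.intGraded i j n)

/-- The `R`-algebra `R B^S(G, G)` for `G = Γ i`. -/
noncomputable def algebra (i : ι) : Subalgebra R (ScalarBurnside R (Γ i) (Γ i)) :=
  (S.burnside R i i).toSubalgebra
    (Submodule.subset_span ⟨1, S.one_mem_restricted i, rfl⟩)
    (by
      intro x y hx hy
      induction hx using Submodule.span_induction with
      | zero => simp
      | add x y _ _ hx hy => simpa [add_mul] using add_mem hx hy
      | smul r x _ hx =>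
        rw [smul_mul_assoc]
        exact Submodule.smul_mem _ r hx
      | mem x hx =>
        obtain ⟨a, ha, rfl⟩ := hx
        induction hy using Submodule.span_induction with
        | zero => simp
        | add x y _ _ hx hy => simpa [mul_add] using add_mem hx hy
        | smul r x _ hx =>
          rw [mul_smul_comm]
          exact Submodule.smul_mem _ r hx
        | mem y hy =>
          obtain ⟨b, hb, rfl⟩ := hy
          refine Submodule.subset_span ⟨a * b, S.tensor_mem_restricted ha hb, ?_⟩
          simp)

/-- `R B^S_n(G, G)` as a submodule of the algebra `R B^S(G, G)`, for `G = Γ i`. -/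
noncomputable def algebraGraded (i : ι) (n : ℕ) : Submodule R (S.algebra R i) :=
  (S.graded R i i n).comap (S.algebra R i).val.toLinearMap

/-- `R B^{Δ(S)}(G, G)` as a submodule of the algebra `R B^S(G, G)`, for `G = Γ i`. -/
noncomputable def algebraBifree (i : ι) : Submodule R (S.algebra R i) :=
  (S.bifree.burnside R i i).comap (S.algebra R i).val.toLinearMap

/-- The Jacobson radical of `R B^S(G, G)` as an `R`-submodule, for `G = Γ i`. -/
noncomputable def radical (i : ι) : Submodule R (S.algebra R i) :=
  (Ring.jacobson (S.algebra R i)).restrictScalars R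

end BisetSystem

/-! Marks serve as coordinates. For every subgroup `L` of `G × H` there is an integral element
`conjElement L` whose mark at `M` counts the `g` with `g M g⁻¹ = L`, so its marks live on one
conjugacy class. It arises by inverting the triangular system `|L| [(G × H)/L] = ∑_{K ≤ L}
conjElement K`, and it stays in the span attached to any set of subgroups that contains `L` and is
closed under taking subgroups. Once `|G × H|` is invertible, every `x` equals `|G × H|⁻¹ ∑_M Φ_M(x)
conjElement M` (`ScalarBurnside.sum_mark_conjElement`). The submodules in question are then given
exactly by the vanishing of marks, and they split along degrees. The degree of `M` is the
composition length of `k₂(M)`, that is, of `ker α` for the graph of `α`.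

Multiplication is controlled by `card_mul_mark_tensor`: for left-free second factors, `|H|
Φ_{(γ,κ)}(ab) = ∑_β Φ_{(γ,β)}(a) Φ_{(β,κ)}(b)`, where `β` runs over homomorphisms `W → H` and
`(γ,κ)` stands for the image of `w ↦ (γ w, κ w)`. In the terms that survive, `ker β ≤ ker γ`, so for
injective `κ` Jordan–Hölder makes the degrees of the two factors add up to the degree of `(γ,κ)`
(`subgroupDegree_add`). Over `ℤ` the factor `|H|` cancels, which proves (a), and linearity passes to
every `R`. Part (b) follows from the inversion formula.

For (c), elements without marks of degree 0 form an ideal and are nilpotent, because the degrees of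
finitely many subgroups are bounded; hence the positive part lies in the radical. Conversely, the
marks of `x` at pairs of embeddings of a fixed `V ≤ G` form a matrix which, up to the scalar `|G|`,
is multiplicative in `x`. For `x` in the radical and any `e`, the product `ex` is nilpotent, so its
matrix has trace 0. If `e` is the basic element at the opposite of a twisted diagonal subgroup `L`
with domain `V`, this trace is a unit times the mark of `x` at `L`: the unit comes from `|G × G|`
and the order of the relevant automorphism group of `V`. So every degree 0 mark of `x` vanishes. -/

/-! ### Composition length: existence, Jordan–Hölder, additivity. -/

namespace HasCompositionSeries

theorem of_mulEquiv {G : Type u} [Group G] {n : ℕ} (h : HasCompositionSeries G n) :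
    ∀ {G' : Type u} [Group G'], G ≃* G' → HasCompositionSeries G' n := by
  induction h with
  | trivial G =>
    intro G' _ e
    have := e.symm.injective.subsingleton
    exact .trivial G'
  | step G N n hs _ ih =>
    intro G' _ e
    have hn : (N.map e.toMonoidHom).Normal := Subgroup.Normal.map ‹_› _ e.surjective
    have e' : G' ⧸ N.map e.toMonoidHom ≃* G ⧸ N :=
      (QuotientGroup.congr N (N.map e.toMonoidHom) e rfl).symm
    exact .step G' (N.map e.toMonoidHom) n e'.isSimpleGroup (ih (e.subgroupMap N))

/-- A maximal proper normal subgroup has simple quotient; induction on the order does the rest. -/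
theorem exists_of_finite (G : Type u) [Group G] [Finite G] : ∃ n, HasCompositionSeries G n := by
  induction hc : Nat.card G using Nat.strong_induction_on generalizing G with
  | _ c ih =>
    rcases subsingleton_or_nontrivial G with h | h
    · exact ⟨0, .trivial G⟩
    · have hfin : {N : Subgroup G | N.Normal ∧ N ≠ ⊤}.Finite := Set.toFinite _
      obtain ⟨N, ⟨hN, hN'⟩, hmax⟩ := hfin.exists_maximal
        ⟨⊥, inferInstance, bot_ne_top⟩
      have hnt : Nontrivial (G ⧸ N) := QuotientGroup.nontrivial_iff.2 hN'
      have hsimple : IsSimpleGroup (G ⧸ N) := by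
        refine ⟨fun M hM => ?_⟩
        have hle : N ≤ M.comap (QuotientGroup.mk' N) := by
          intro x hx
          have : (QuotientGroup.mk' N) x = 1 := (QuotientGroup.eq_one_iff x).2 hx
          rw [Subgroup.mem_comap, this]
          exact M.one_mem
        by_cases hM' : M.comap (QuotientGroup.mk' N) = ⊤
        · right
          rw [eq_top_iff]
          intro y _
          obtain ⟨x, rfl⟩ := QuotientGroup.mk'_surjective N y
          have : x ∈ M.comap (QuotientGroup.mk' N) := hM' ▸ Subgroup.mem_top x
          exact this
        · left
          have := hmax ⟨hM.comap _, hM'⟩ hle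
          rw [eq_bot_iff]
          intro y hy
          obtain ⟨x, rfl⟩ := QuotientGroup.mk'_surjective N y
          exact (QuotientGroup.eq_one_iff x).2 (this hy)
      obtain ⟨n, hn⟩ := ih (Nat.card N)
        (hc ▸ lt_of_le_of_ne (Nat.le_of_dvd Nat.card_pos N.card_subgroup_dvd_card)
          fun h => hN' (Subgroup.eq_top_of_card_eq N h)) N rfl
      exact ⟨n + 1, .step G N n hsimple hn⟩

theorem pos_of_nontrivial {G : Type u} [Group G] [Nontrivial G] {n : ℕ}
    (h : HasCompositionSeries G n) : 0 < n := by
  cases h with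
  | trivial => exact (not_subsingleton G ‹_›).elim
  | step => exact Nat.succ_pos _

theorem eq_zero_of_subsingleton {G : Type u} [Group G] [Subsingleton G] {n : ℕ}
    (h : HasCompositionSeries G n) : n = 0 := by
  cases h with
  | trivial => rfl
  | step _ N n hs =>
    have := hs.toNontrivial
    exact (not_subsingleton (G ⧸ N)
      (QuotientGroup.mk'_surjective N).subsingleton).elim

/-- A composition series of the kernel and one of the image combine to a composition series. -/
theorem of_surjective {Q : Type u} [Group Q] {b : ℕ} (hQ : HasCompositionSeries Q b) :
    ∀ {G : Type u} [Group G] (f : G →* Q), Function.Surjective f → ∀ {a : ℕ},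
      HasCompositionSeries f.ker a → HasCompositionSeries G (a + b) := by
  induction hQ with
  | trivial Q =>
    intro G _ f _ a ha
    have : f.ker = ⊤ := by
      rw [eq_top_iff]
      intro x _
      exact Subsingleton.elim _ _
    exact ha.of_mulEquiv ((MulEquiv.subgroupCongr this).trans Subgroup.topEquiv)
  | step Q N n hs _ ih =>
    intro G _ f hf a ha
    -- The top step of the series of `Q` is pulled back along `f`; the restriction of `f` to the
    -- preimage of `N` has the same kernel as `f`, so the induction hypothesis applies to it.
    have e : G ⧸ N.comap f ≃* Q ⧸ N := by
      have h : N.comap f = ((QuotientGroup.mk' N).comp f).ker := by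
        rw [← MonoidHom.comap_ker, QuotientGroup.ker_mk']
      exact (QuotientGroup.quotientMulEquivOfEq h).trans
        (QuotientGroup.quotientKerEquivOfSurjective _
          ((QuotientGroup.mk'_surjective N).comp hf))
    let g : N.comap f →* N := f.subgroupComap N
    have hg : Function.Surjective g := MonoidHom.subgroupComap_surjective_of_surjective f N hf
    let ek : f.ker ≃* g.ker :=
      { toFun := fun x => ⟨⟨x, by
            have : f x = 1 := x.2
            rw [Subgroup.mem_comap, this]; exact N.one_mem⟩, Subtype.ext x.2⟩
        invFun := fun x => ⟨x.1.1, congrArg Subtype.val x.2⟩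
        left_inv := fun _ => rfl
        right_inv := fun _ => rfl
        map_mul' := fun _ _ => rfl }
    exact .step G (N.comap f) (a + n) e.isSimpleGroup (ih g hg (ha.of_mulEquiv ek))

/-- The Jordan–Hölder theorem for lengths. -/
theorem unique {G : Type u} [Group G] [Finite G] {m n : ℕ} (hm : HasCompositionSeries G m)
    (hn : HasCompositionSeries G n) : m = n := by
  induction hc : Nat.card G using Nat.strong_induction_on generalizing G m n with
  | _ c ih =>
    cases hm with
    | trivial => exact hn.eq_zero_of_subsingleton.symm
    | step _ N a hN ha =>
      cases hn with
      | trivial => exact (HasCompositionSeries.step G N a hN ha).eq_zero_of_subsingleton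
      | step _ M b hM hb =>
        have hlt : ∀ (N : Subgroup G) [N.Normal], IsSimpleGroup (G ⧸ N) → Nat.card N < c := by
          intro N _ hN
          refine hc ▸ lt_of_le_of_ne (Nat.le_of_dvd Nat.card_pos N.card_subgroup_dvd_card)
            fun h => ?_
          have := hN.toNontrivial
          exact QuotientGroup.nontrivial_iff.1 this (Subgroup.eq_top_of_card_eq N h)
        by_cases hNM : N = M
        · subst hNM
          rw [ih _ (hlt N hN) ha hb rfl]
        · have hmax : ∀ (N M : Subgroup G) [N.Normal] [M.Normal], IsSimpleGroup (G ⧸ N) →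
              ¬ M ≤ N → N ⊔ M = ⊤ := by
            intro N M _ hM' hN h
            have hnorm : ((N ⊔ M).map (QuotientGroup.mk' N)).Normal :=
              Subgroup.Normal.map inferInstance _ (QuotientGroup.mk'_surjective N)
            rcases hN.eq_bot_or_eq_top_of_normal _ hnorm with h1 | h1
            · refine (h fun x hx => ?_).elim
              have : QuotientGroup.mk' N x ∈ (N ⊔ M).map (QuotientGroup.mk' N) :=
                Subgroup.mem_map_of_mem _ (Subgroup.mem_sup_right hx)
              rw [h1, Subgroup.mem_bot] at this
              exact (QuotientGroup.eq_one_iff x).1 this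
            · rw [eq_top_iff]
              intro x _
              have : QuotientGroup.mk' N x ∈ (N ⊔ M).map (QuotientGroup.mk' N) :=
                h1 ▸ Subgroup.mem_top _
              obtain ⟨y, hy, hxy⟩ := this
              have h2 : y⁻¹ * x ∈ N := QuotientGroup.eq.1 hxy
              have := mul_mem hy (Subgroup.mem_sup_left (T := M) h2)
              simpa using this
          have hsup : N ⊔ M = ⊤ := by
            by_cases hle : M ≤ N
            · rw [sup_comm]
              exact hmax M N hM fun h => hNM (le_antisymm h hle)
            · exact hmax N M hN hle
          -- Second isomorphism theorem: `N / (N ⊓ M) ≅ G / M` is simple. Thus one series of `N ⊓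
          -- M`, of length `d`, extends to series of length `d + 1` of both `N` and `M`, and these
          -- can be compared with the given ones by induction.
          have key : ∀ (N M : Subgroup G) [N.Normal] [M.Normal], IsSimpleGroup (G ⧸ M) →
              N ⊔ M = ⊤ → ∀ d, HasCompositionSeries (N ⊓ M : Subgroup G) d →
                HasCompositionSeries N (d + 1) := by
            intro N M _ _ hM hsup d hd
            let f : N →* G ⧸ M := (QuotientGroup.mk' M).comp N.subtype
            have hf : Function.Surjective f := by
              intro y
              obtain ⟨x, rfl⟩ := QuotientGroup.mk'_surjective M y
              have hx : x ∈ N ⊔ M := hsup ▸ Subgroup.mem_top x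
              obtain ⟨p, hp, q, hq, rfl⟩ := Subgroup.mem_sup_of_normal_right.1 hx
              exact ⟨⟨p, hp⟩, QuotientGroup.eq.2 (by simpa using hq)⟩
            let e : (N ⊓ M : Subgroup G) ≃* f.ker :=
              { toFun := fun x => ⟨⟨x, x.2.1⟩, (QuotientGroup.eq_one_iff _).2 x.2.2⟩
                invFun := fun x => ⟨x.1, x.1.2, (QuotientGroup.eq_one_iff _).1 x.2⟩
                left_inv := fun _ => rfl
                right_inv := fun _ => rfl
                map_mul' := fun _ _ => rfl }
            exact .step N f.ker d
              (QuotientGroup.quotientKerEquivOfSurjective f hf).isSimpleGroup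
              (hd.of_mulEquiv e)
          obtain ⟨d, hd⟩ := exists_of_finite (N ⊓ M : Subgroup G)
          have h1 := ih _ (hlt N hN) ha (key N M hM hsup d hd) rfl
          have h2 := ih _ (hlt M hM) hb
            (key M N hN (sup_comm N M ▸ hsup) d
              (hd.of_mulEquiv (MulEquiv.subgroupCongr (inf_comm _ _)))) rfl
          rw [h1, h2]

theorem compositionLength_eq {G : Type u} [Group G] [Finite G] {n : ℕ}
    (h : HasCompositionSeries G n) : compositionLength G = n := by
  have h' : compositionLength G ∈ {n | HasCompositionSeries G n} := Nat.sInf_mem ⟨n, h⟩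
  exact unique h' h

end HasCompositionSeries

theorem hasCompositionSeries_compositionLength (G : Type u) [Group G] [Finite G] :
    HasCompositionSeries G (compositionLength G) :=
  Nat.sInf_mem (s := {n | HasCompositionSeries G n}) (HasCompositionSeries.exists_of_finite G)

theorem compositionLength_congr {G G' : Type u} [Group G] [Group G'] [Finite G] (e : G ≃* G') :
    compositionLength G = compositionLength G' := by
  have : Finite G' := Finite.of_equiv G e.toEquiv
  exact ((hasCompositionSeries_compositionLength G).of_mulEquiv e).compositionLength_eq.symm

theorem compositionLength_eq_add {G Q : Type u} [Group G] [Group Q] [Finite G] (f : G →* Q)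
    (hf : Function.Surjective f) :
    compositionLength G = compositionLength f.ker + compositionLength Q := by
  have : Finite Q := Finite.of_surjective f hf
  exact ((hasCompositionSeries_compositionLength Q).of_surjective f hf
    (hasCompositionSeries_compositionLength f.ker)).compositionLength_eq

theorem compositionLength_eq_zero_iff {G : Type u} [Group G] [Finite G] :
    compositionLength G = 0 ↔ Subsingleton G := by
  constructor
  · intro h
    by_contra hG
    have := not_subsingleton_iff_nontrivial.1 hG
    exact (hasCompositionSeries_compositionLength G).pos_of_nontrivial.ne' h
  · intro h
    exact (hasCompositionSeries_compositionLength G).eq_zero_of_subsingleton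

noncomputable instance subgroupFintype (A : Type u) [Group A] [Finite A] : Fintype (Subgroup A) :=
  Fintype.ofFinite _

/-! ### Conjugate subgroups and the marks of transitive bisets. -/

section Conjugation

variable {A : Type u} [Group A]

/-- The conjugate `g M g⁻¹`. -/
def conjSubgroup (g : A) (M : Subgroup A) : Subgroup A := M.map (MulAut.conj g).toMonoidHom

theorem mem_conjSubgroup {g x : A} {M : Subgroup A} :
    x ∈ conjSubgroup g M ↔ g⁻¹ * x * g ∈ M := by
  constructor
  · rintro ⟨y, hy, rfl⟩
    simpa [mul_assoc] using hy
  · intro h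
    exact ⟨_, h, by simp [mul_assoc]⟩

theorem conjSubgroup_one (M : Subgroup A) : conjSubgroup 1 M = M := by
  ext x
  simp [mem_conjSubgroup]

theorem conjSubgroup_mul (g h : A) (M : Subgroup A) :
    conjSubgroup (g * h) M = conjSubgroup g (conjSubgroup h M) := by
  ext x
  simp [mem_conjSubgroup, mul_assoc]

theorem conjSubgroup_le_iff {g : A} {M L : Subgroup A} :
    conjSubgroup g M ≤ L ↔ M ≤ conjSubgroup g⁻¹ L := by
  constructor
  · intro h x hx
    exact mem_conjSubgroup.2 (h (mem_conjSubgroup.2 (by simpa [mul_assoc] using hx)))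
  · intro h x hx
    simpa [mem_conjSubgroup, mul_assoc] using h (mem_conjSubgroup.1 hx)

theorem conjSubgroup_eq_iff {g : A} {M L : Subgroup A} :
    conjSubgroup g M = L ↔ M = conjSubgroup g⁻¹ L := by
  constructor
  · rintro rfl
    rw [← conjSubgroup_mul, inv_mul_cancel, conjSubgroup_one]
  · rintro rfl
    rw [← conjSubgroup_mul, mul_inv_cancel, conjSubgroup_one]

/-- Conjugation by `g` as an order automorphism of the lattice of subgroups. -/
def conjOrderIso (g : A) : Subgroup A ≃o Subgroup A where
  toFun := conjSubgroup g
  invFun := conjSubgroup g⁻¹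
  left_inv M := by rw [← conjSubgroup_mul, inv_mul_cancel, conjSubgroup_one]
  right_inv M := by rw [← conjSubgroup_mul, mul_inv_cancel, conjSubgroup_one]
  map_rel_iff' {M L} := by
    change conjSubgroup g M ≤ conjSubgroup g L ↔ _
    rw [conjSubgroup_le_iff, ← conjSubgroup_mul, inv_mul_cancel, conjSubgroup_one]

theorem card_conjSubgroup (g : A) (M : Subgroup A) : Nat.card (conjSubgroup g M) = Nat.card M :=
  (Nat.card_congr (M.equivMapOfInjective _ (MulAut.conj g).injective).toEquiv).symm

/-- The number of elements conjugating `M` to `L`. -/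
noncomputable def conjCount (M L : Subgroup A) : ℕ := Nat.card {g : A // conjSubgroup g M = L}

theorem conjCount_ne_zero {M L : Subgroup A} (h : conjCount M L ≠ 0) :
    ∃ g : A, conjSubgroup g M = L := by
  by_contra! hg
  have : IsEmpty {g : A // conjSubgroup g M = L} := ⟨fun x => hg x.1 x.2⟩
  exact h (by rw [conjCount, Nat.card_of_isEmpty])

-- The elements `g` are sorted according to the value of `g M g⁻¹`.
open Classical in
theorem sum_conjCount [Finite A] (M L : Subgroup A) :
    ∑ K ∈ Finset.univ.filter (· ≤ L), conjCount M K = Nat.card {g : A // conjSubgroup g M ≤ L} := by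
  have := Fintype.ofFinite A
  simp only [conjCount, Nat.card_eq_fintype_card, Fintype.card_subtype]
  rw [← Finset.card_biUnion]
  · congr 1
    ext g
    simp
  · intro K _ K' _ hne
    rw [Function.onFun, Finset.disjoint_left]
    intro g hg hg'
    simp only [Finset.mem_filter, Finset.mem_univ, true_and] at hg hg'
    exact hne (hg.symm.trans hg')

end Conjugation

namespace Biset

variable {G H : Type u} [Group G] [Group H]

/-- Right multiplication by `g` sends a coset of `g L g⁻¹` to a coset of `L`. -/
theorem coset_iso_conj [Finite G] [Finite H] (L : Subgroup (G × H)) (g : G × H) :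
    Iso (coset (conjSubgroup g L)) (coset L) := by
  let f : (coset (conjSubgroup g L)).carrier → (coset L).carrier :=
    Quotient.map' (s₁ := QuotientGroup.leftRel _) (s₂ := QuotientGroup.leftRel _) (· * g) (by
      intro x y h
      rw [QuotientGroup.leftRel_apply] at h ⊢
      simpa [mem_conjSubgroup, mul_assoc] using h)
  refine iso_of_bijective f ⟨?_, ?_⟩ ?_
  · rintro ⟨x⟩ ⟨y⟩ h
    have h' : (x * g)⁻¹ * (y * g) ∈ L := QuotientGroup.eq.1 h
    exact QuotientGroup.eq.2 (mem_conjSubgroup.2 (by simpa [mul_assoc] using h'))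
  · rintro ⟨x⟩
    exact ⟨((x * g⁻¹ : G × H) : (G × H) ⧸ conjSubgroup g L),
      congrArg (QuotientGroup.mk (s := L)) (inv_mul_cancel_right x g)⟩
  · rintro a ⟨x⟩
    exact congrArg (QuotientGroup.mk (s := L)) (mul_assoc a x g)

theorem mk_mem_fixedSet_coset [Finite G] [Finite H] {L M : Subgroup (G × H)} {x : G × H} :
    (x : (G × H) ⧸ L) ∈ (coset L).fixedSet M ↔ conjSubgroup x⁻¹ M ≤ L := by
  constructor
  · intro h y hy
    have h1 := h _ (mem_conjSubgroup.1 hy)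
    have h2 : ((x⁻¹⁻¹ * y * x⁻¹) * x)⁻¹ * x ∈ L := QuotientGroup.eq.1 h1
    have : y = (((x⁻¹⁻¹ * y * x⁻¹) * x)⁻¹ * x)⁻¹ := by group
    rw [this]
    exact L.inv_mem h2
  · intro h a ha
    refine QuotientGroup.eq.2 ?_
    have : x⁻¹ * a * x ∈ L := h (mem_conjSubgroup.2 (by simpa [mul_assoc] using ha))
    have := L.inv_mem this
    simpa [mul_assoc] using this

/-- The left side counts the `x` whose coset is fixed by `M`, each fixed coset containing `|L|` of
them; `x ↦ x⁻¹` turns this into the right side. -/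
theorem card_mul_card_fixedSet_coset [Finite G] [Finite H] (L M : Subgroup (G × H)) :
    Nat.card L * Nat.card ((coset L).fixedSet M) =
      Nat.card {g : G × H // conjSubgroup g M ≤ L} := by
  have e := QuotientGroup.preimageMkEquivSubgroupProdSet L ((coset L).fixedSet M)
  refine (Nat.card_prod _ _).symm.trans ((Nat.card_congr e).symm.trans ?_)
  exact Nat.card_congr ((Equiv.inv (G × H)).subtypeEquiv fun x => mk_mem_fixedSet_coset)

end Biset

/-! ### Elements with marks on a single conjugacy class, and the inversion formula. -/

namespace DoubleBurnside

variable {G H : Type u} [Group G] [Group H]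

theorem mark_conj (x : DoubleBurnside G H) (g : G × H) (M : Subgroup (G × H)) :
    mark (conjSubgroup g M) x = mark M x := by
  refine DFunLike.congr_fun (hom_ext fun X => ?_) x
  rw [mark_cls, mark_cls]
  refine congrArg Nat.cast (Nat.card_congr
    ((MulAction.toPerm (g⁻¹ : G × H)).subtypeEquiv fun y => ?_))
  constructor
  · intro h a ha
    have := h (g * a * g⁻¹) (mem_conjSubgroup.2 (by simpa [mul_assoc] using ha))
    rw [mul_smul, mul_smul, smul_eq_iff_eq_inv_smul] at this
    exact this
  · intro h a ha
    have := h _ (mem_conjSubgroup.1 ha)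
    change (g⁻¹ * a * g) • g⁻¹ • y = g⁻¹ • y at this
    rw [mul_smul, smul_inv_smul, mul_smul] at this
    exact smul_left_cancel _ this

variable [Finite G] [Finite H]

theorem card_mul_mark_coset (L M : Subgroup (G × H)) :
    (Nat.card L : ℤ) * mark M (cls (Biset.coset L)) =
      Nat.card {g : G × H // conjSubgroup g M ≤ L} := by
  rw [mark_cls]
  exact_mod_cast Biset.card_mul_card_fixedSet_coset L M

open Classical in
/-- The element of the double Burnside group whose mark at `M` is the number of elements
conjugating `M` to `L`. -/
noncomputable def conjElement (L : Subgroup (G × H)) : DoubleBurnside G H :=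
  Nat.card L • cls (Biset.coset L) - ∑ K : {K : Subgroup (G × H) // K < L}, conjElement K.1
termination_by Nat.card L
decreasing_by
  exact Set.ncard_lt_ncard K.2

open Classical in
theorem conjElement_eq (L : Subgroup (G × H)) :
    conjElement L = Nat.card L • cls (Biset.coset L) -
      ∑ K ∈ Finset.univ.filter (· < L), conjElement K := by
  rw [conjElement]
  congr 1
  exact (Finset.sum_subtype _ (by simp) _).symm

open Classical in
theorem sum_conjElement (L : Subgroup (G × H)) :
    ∑ K ∈ Finset.univ.filter (· ≤ L), conjElement K = Nat.card L • cls (Biset.coset L) := by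
  have : Finset.univ.filter (· ≤ L) = insert L (Finset.univ.filter (· < L)) := by
    ext K
    simp [le_iff_eq_or_lt]
  rw [this, Finset.sum_insert (by simp), conjElement_eq L, sub_add_cancel]

/-- The recursion defining `conjElement` only descends to subgroups, so it never leaves `T`. -/
theorem conjElement_mem_restricted {T : Set (Subgroup (G × H))}
    (hT : ∀ L ∈ T, ∀ M ≤ L, M ∈ T) {L : Subgroup (G × H)} (hL : L ∈ T) :
    conjElement L ∈ restricted T := by
  classical
  induction L using WellFoundedLT.induction with
  | _ L ih =>
    rw [conjElement_eq]
    have hm : cls (Biset.coset L) ∈ restricted T := AddSubgroup.subset_closure ⟨L, hL, rfl⟩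
    refine sub_mem (nsmul_mem hm _) (sum_mem fun K hK => ?_)
    have hK := (Finset.mem_filter.1 hK).2
    exact ih K hK (hT L hL K hK.le)

/-- The marks and the counts `conjCount M L` have equal sums over all `K ≤ L`, by `sum_conjElement`
and `sum_conjCount`; the two triangular systems therefore have the same solution. -/
theorem mark_conjElement (L M : Subgroup (G × H)) :
    mark M (conjElement L) = conjCount M L := by
  classical
  induction L using WellFoundedLT.induction with
  | _ L ih =>
    have h1 : mark M (∑ K ∈ Finset.univ.filter (· ≤ L), conjElement K) =
        ∑ K ∈ Finset.univ.filter (· ≤ L), (conjCount M K : ℤ) := by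
      rw [sum_conjElement, map_nsmul, nsmul_eq_mul, card_mul_mark_coset, ← sum_conjCount]
      push_cast
      rfl
    have : Finset.univ.filter (· ≤ L) = insert L (Finset.univ.filter (· < L)) := by
      ext K
      simp [le_iff_eq_or_lt]
    rw [this, Finset.sum_insert (by simp), Finset.sum_insert (by simp), map_add, map_sum,
      Finset.sum_congr rfl fun K hK => ih K (Finset.mem_filter.1 hK).2] at h1
    exact add_right_cancel h1

theorem conjElement_conj (g : G × H) (L : Subgroup (G × H)) :
    conjElement (conjSubgroup g L) = conjElement L := by
  classical
  induction L using WellFoundedLT.induction with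
  | _ L ih =>
    rw [conjElement_eq, conjElement_eq L, card_conjSubgroup, cls_eq (Biset.coset_iso_conj L g)]
    congr 1
    refine (Finset.sum_bij (fun K _ => conjSubgroup g K) ?_ ?_ ?_ ?_).symm
    · intro K hK
      simp only [Finset.mem_filter, Finset.mem_univ, true_and] at hK ⊢
      exact (conjOrderIso g).lt_iff_lt.2 hK
    · intro K _ K' _ h
      exact (conjOrderIso g).injective h
    · intro K hK
      simp only [Finset.mem_filter, Finset.mem_univ, true_and] at hK ⊢
      refine ⟨conjSubgroup g⁻¹ K, ?_, (conjOrderIso g).apply_symm_apply K⟩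
      exact (conjOrderIso g).symm_apply_lt.2 hK
    · intro K hK
      exact (ih K (Finset.mem_filter.1 hK).2).symm

/-- The inversion formula for marks, on the elements `conjElement L`. -/
theorem sum_conjCount_conjElement (L : Subgroup (G × H)) :
    ∑ M : Subgroup (G × H), conjCount M L • (conjElement M : DoubleBurnside G H) =
      Nat.card (G × H) • conjElement L := by
  classical
  have := Fintype.ofFinite (G × H)
  have h1 : ∀ M, conjCount M L • (conjElement M : DoubleBurnside G H) =
      ∑ g : G × H, if conjSubgroup g M = L then conjElement M else 0 := by
    intro M
    rw [← Finset.sum_filter, Finset.sum_const, conjCount, Nat.card_eq_fintype_card,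
      Fintype.card_subtype]
  simp_rw [h1]
  rw [Finset.sum_comm]
  -- For each `g` only `M = g⁻¹ L g` contributes, and its basic element is that of `L`.
  simp_rw [conjSubgroup_eq_iff, Finset.sum_ite_eq', Finset.mem_univ, if_true, conjElement_conj]
  simp

/-- The inversion formula for marks. -/
theorem card_mul_sum_mark_conjElement (x : DoubleBurnside G H) :
    Nat.card (G × H) • ∑ M : Subgroup (G × H), mark M x • conjElement M =
      Nat.card (G × H) • (Nat.card (G × H) • x) := by
  classical
  let φ : DoubleBurnside G H →+ DoubleBurnside G H :=
    { toFun := fun x => ∑ M : Subgroup (G × H), mark M x • conjElement M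
      map_zero' := by simp
      map_add' := fun x y => by simp [add_smul, Finset.sum_add_distrib] }
  have hφ : ∀ L, φ (conjElement L) = Nat.card (G × H) • conjElement L := by
    intro L
    rw [← sum_conjCount_conjElement]
    refine Finset.sum_congr rfl fun M _ => ?_
    rw [mark_conjElement, natCast_zsmul]
  -- Only `|L| • cls (coset L)` is a sum of basic elements. Instead of cancelling `|L|`, which would
  -- need torsion-freeness, both sides are multiplied by the index `m`; this is the source of the
  -- extra factor `|G × H|` in the statement.
  have hc : ∀ L : Subgroup (G × H), Nat.card (G × H) • φ (cls (Biset.coset L)) =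
      Nat.card (G × H) • (Nat.card (G × H) • cls (Biset.coset L)) := by
    intro L
    obtain ⟨m, hm⟩ := L.card_subgroup_dvd_card
    have h2 : φ (Nat.card L • cls (Biset.coset L)) =
        Nat.card (G × H) • (Nat.card L • cls (Biset.coset L)) := by
      rw [← sum_conjElement, map_sum, Finset.smul_sum]
      exact Finset.sum_congr rfl fun K _ => hφ K
    rw [map_nsmul] at h2
    calc Nat.card (G × H) • φ (cls (Biset.coset L))
        = m • Nat.card L • φ (cls (Biset.coset L)) := by rw [hm, mul_comm, mul_smul]
      _ = Nat.card (G × H) • m • Nat.card L • cls (Biset.coset L) := by rw [h2, smul_comm]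
      _ = _ := by rw [← mul_smul m, mul_comm m, ← hm]
  have hx : x ∈ restricted (Set.univ : Set (Subgroup (G × H))) := by
    induction x using cls_induction with
    | h0 => exact zero_mem _
    | ha x y hx hy => exact add_mem hx hy
    | hn x hx => exact neg_mem hx
    | hc X => exact cls_mem_restricted X fun _ => Set.mem_univ _
  change Nat.card (G × H) • φ x = _
  induction hx using AddSubgroup.closure_induction with
  | zero => simp
  | add x y _ _ hx hy => simp only [map_add, smul_add, hx, hy]
  | neg x _ hx => simp only [map_neg, smul_neg, hx]
  | mem x hx =>
    obtain ⟨L, -, rfl⟩ := hx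
    exact hc L

end DoubleBurnside

noncomputable instance monoidHomFintype (A : Type u) (B : Type v) [Group A] [Group B] [Finite A]
    [Finite B] : Fintype (A →* B) :=
  have : Finite (A →* B) := DFunLike.finite _
  Fintype.ofFinite _

namespace DoubleBurnside

variable {G H : Type u} [Group G] [Group H] [Finite G] [Finite H]

/-- A fixed point of `M` on `(G × H) / L` makes `M` conjugate to a subgroup of `L`, and `T` is
closed under both operations. -/
theorem mark_eq_zero_of_mem_restricted {T : Set (Subgroup (G × H))}
    (hT : ∀ L ∈ T, ∀ M ≤ L, M ∈ T) (hT' : ∀ L ∈ T, ∀ g : G × H, conjSubgroup g L ∈ T)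
    {a : DoubleBurnside G H} (ha : a ∈ restricted T) {M : Subgroup (G × H)} (hM : M ∉ T) :
    mark M a = 0 := by
  induction ha using AddSubgroup.closure_induction with
  | zero => simp
  | add x y _ _ hx hy => rw [map_add, hx, hy, add_zero]
  | neg x _ hx => rw [map_neg, hx, neg_zero]
  | mem x hx =>
    obtain ⟨L, hL, rfl⟩ := hx
    have h : IsEmpty {g : G × H // conjSubgroup g M ≤ L} :=
      ⟨fun g => hM (hT _ (hT' L hL _) _ (conjSubgroup_le_iff.1 g.2))⟩
    have := card_mul_mark_coset L M
    rw [@Nat.card_of_isEmpty _ h, Nat.cast_zero] at this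
    exact (mul_eq_zero.1 this).resolve_left (Nat.cast_ne_zero.2 Nat.card_pos.ne')

end DoubleBurnside

/-! ### Marks and inversion over a ring of scalars. -/

namespace ScalarBurnside

open DoubleBurnside

variable {R : Type w} [CommRing R] {G H K : Type u} [Group G] [Group H] [Group K]

theorem mem_extend_of_mem {A : AddSubgroup (DoubleBurnside G H)} {a : DoubleBurnside G H}
    (ha : a ∈ A) : (1 : R) ⊗ₜ[ℤ] a ∈ extend R A :=
  Submodule.subset_span ⟨a, ha, rfl⟩

theorem mark_one_tmul (L : Subgroup (G × H)) (a : DoubleBurnside G H) :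
    mark R L (1 ⊗ₜ a) = (DoubleBurnside.mark L a : R) := by
  rw [mark_tmul, one_mul]

theorem mark_conj (x : ScalarBurnside R G H) (g : G × H) (M : Subgroup (G × H)) :
    mark R (conjSubgroup g M) x = mark R M x := by
  induction x using TensorProduct.induction_on with
  | zero => simp
  | add x y hx hy => rw [map_add, map_add, hx, hy]
  | tmul r x => rw [mark_tmul, mark_tmul, DoubleBurnside.mark_conj]

theorem mark_eq_zero_of_mem_extend {A : AddSubgroup (DoubleBurnside G H)} {M : Subgroup (G × H)}
    (hA : ∀ a ∈ A, DoubleBurnside.mark M a = 0) {x : ScalarBurnside R G H} (hx : x ∈ extend R A) :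
    mark R M x = 0 := by
  induction hx using Submodule.span_induction with
  | zero => simp
  | add x y _ _ hx hy => rw [map_add, hx, hy, add_zero]
  | smul r x _ hx => rw [map_smul, hx, smul_zero]
  | mem x hx =>
    obtain ⟨a, ha, rfl⟩ := hx
    rw [mark_one_tmul, hA a ha, Int.cast_zero]

variable [Finite G] [Finite H]

/-- The inversion formula for marks. -/
theorem sum_mark_conjElement (hu : IsUnit (Nat.card (G × H) : R)) (x : ScalarBurnside R G H) :
    ∑ M : Subgroup (G × H), mark R M x • (1 : R) ⊗ₜ[ℤ] conjElement M =
      (Nat.card (G × H) : R) • x := by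
  refine hu.smul_left_cancel.1 ?_
  induction x using TensorProduct.induction_on with
  | zero => simp
  | add x y hx hy =>
    simp only [map_add, add_smul, Finset.sum_add_distrib, smul_add] at hx hy ⊢
    rw [hx, hy]
  | tmul r x =>
    have h := congrArg (fun y => r ⊗ₜ[ℤ] y) (card_mul_sum_mark_conjElement x)
    simp only [TensorProduct.tmul_smul, TensorProduct.tmul_sum, ← Nat.cast_smul_eq_nsmul R] at h
    rw [← h]
    congr 1
    refine Finset.sum_congr rfl fun M _ => ?_
    rw [mark_tmul, TensorProduct.smul_tmul', smul_eq_mul, mul_one, mul_comm, ← zsmul_eq_mul,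
      TensorProduct.smul_tmul']

theorem eq_zero_of_mark_eq_zero (hu : IsUnit (Nat.card (G × H) : R)) {x : ScalarBurnside R G H}
    (hx : ∀ M, mark R M x = 0) : x = 0 := by
  refine hu.smul_left_cancel.1 ?_
  rw [← sum_mark_conjElement hu x, smul_zero]
  exact Finset.sum_eq_zero fun M _ => by rw [hx, zero_smul]

/-- `extend R A` is a span of integral elements, whereas the right side is a condition over `R`. The
basic elements, being integral, bridge the two: by inversion `x` is a combination of those at which
its mark survives. All later descriptions of submodules by marks rest on this. -/
theorem mem_extend_iff (hu : IsUnit (Nat.card (G × H) : R)) {A : AddSubgroup (DoubleBurnside G H)}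
    {P : Subgroup (G × H) → Prop} (h1 : ∀ a ∈ A, ∀ M, ¬ P M → DoubleBurnside.mark M a = 0)
    (h2 : ∀ M, P M → conjElement M ∈ A) {x : ScalarBurnside R G H} :
    x ∈ extend R A ↔ ∀ M, ¬ P M → mark R M x = 0 := by
  constructor
  · exact fun hx M hM => mark_eq_zero_of_mem_extend (fun a ha => h1 a ha M hM) hx
  · intro hx
    have h : (Nat.card (G × H) : R) • x ∈ extend R A := by
      rw [← sum_mark_conjElement hu x]
      refine sum_mem fun M _ => ?_
      by_cases hM : P M
      · exact Submodule.smul_mem _ _ (mem_extend_of_mem (h2 M hM))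
      · rw [hx M hM, zero_smul]
        exact zero_mem _
    exact (Submodule.smul_mem_iff_of_isUnit _ hu).1 h

end ScalarBurnside

/-! ### Marks of tensor products. -/

section PairRange

variable {G H K W : Type u} [Group G] [Group H] [Group K] [Group W]

/-- The subgroup `{(γ(w), κ(w)) | w ∈ W}`. -/
def pairRange (γ : W →* G) (κ : W →* H) : Subgroup (G × H) := (γ.prod κ).range

theorem pairRange_fst_snd (M : Subgroup (G × H)) :
    pairRange ((MonoidHom.fst G H).comp M.subtype) ((MonoidHom.snd G H).comp M.subtype) = M := by
  ext x
  constructor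
  · rintro ⟨w, rfl⟩
    exact w.2
  · intro hx
    exact ⟨⟨x, hx⟩, rfl⟩

theorem mem_leftFree_iff {L : Subgroup (G × H)} :
    L ∈ leftFreeSubgroups G H ↔ ∀ g, (g, 1) ∈ L → g = 1 :=
  Subgroup.eq_bot_iff_forall _

theorem pairRange_mem_leftFree {γ : W →* G} {κ : W →* H} :
    pairRange γ κ ∈ leftFreeSubgroups G H ↔ κ.ker ≤ γ.ker := by
  rw [mem_leftFree_iff]
  constructor
  · intro h w hw
    exact h (γ w) ⟨w, Prod.ext rfl hw⟩
  · rintro h g ⟨w, hw⟩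
    obtain ⟨h1, h2⟩ := Prod.ext_iff.1 hw
    exact h1.symm.trans (h (show w ∈ κ.ker from h2))

theorem conj_pairRange (g : G × H) (γ : W →* G) (κ : W →* H) :
    conjSubgroup g (pairRange γ κ) = pairRange ((MulAut.conj g.1).toMonoidHom.comp γ)
      ((MulAut.conj g.2).toMonoidHom.comp κ) := by
  ext x
  constructor
  · rintro ⟨_, ⟨w, rfl⟩, rfl⟩
    exact ⟨w, rfl⟩
  · rintro ⟨w, rfl⟩
    exact ⟨_, ⟨w, rfl⟩, rfl⟩

namespace Biset

/-- A biset on which the left group acts freely. -/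
def LeftFree (Y : Biset H K) : Prop := ∀ (y : Y.carrier) (h : H), ((h, 1) : H × K) • y = y → h = 1

theorem LeftFree.eq_of_smul_eq {Y : Biset H K} (hY : Y.LeftFree) {y : Y.carrier} {h h' : H}
    {k : K} (e : ((h, k) : H × K) • y = ((h', k) : H × K) • y) : h = h' := by
  have h1 : ((h'⁻¹ * h, 1) : H × K) • ((1, k) : H × K) • y = ((1, k) : H × K) • y := by
    have e1 : ((h'⁻¹ * h, 1) : H × K) * (1, k) = (h'⁻¹, 1) * (h, k) := by simp
    have e2 : ((h'⁻¹, 1) : H × K) * (h', k) = (1, k) := by simp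
    rw [← mul_smul, e1, mul_smul, e, ← mul_smul, e2]
  exact (inv_mul_eq_one.1 (hY _ _ h1)).symm

theorem mem_fixedSet_pairRange {X : Biset G H} {γ : W →* G} {κ : W →* H} {x : X.carrier} :
    x ∈ X.fixedSet (pairRange γ κ) ↔ ∀ w, ((γ w, κ w) : G × H) • x = x := by
  constructor
  · exact fun h w => h _ ⟨w, rfl⟩
  · rintro h _ ⟨w, rfl⟩
    exact h w

/-- If `(γ w, κ w)` fixes the class of `(x, y)`, some `h ∈ H` compensates: `(γ w, h)` fixes `x` and
`(h, κ w)` fixes `y`. Since `H` acts freely on `Y`, this `h` is unique, so it depends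
multiplicatively on `w` and defines `β`. -/
theorem tmk_mem_fixedSet_iff {X : Biset G H} {Y : Biset H K} (hY : Y.LeftFree) {γ : W →* G}
    {κ : W →* K} {x : X.carrier} {y : Y.carrier} :
    tmk X Y x y ∈ (tensor X Y).fixedSet (pairRange γ κ) ↔
      ∃ β : W →* H, x ∈ X.fixedSet (pairRange γ β) ∧ y ∈ Y.fixedSet (pairRange β κ) := by
  have key : ∀ w h, (x = ((1, h) : G × H) • ((γ w, 1) : G × H) • x ∧
      y = ((h, 1) : H × K) • ((1, κ w) : H × K) • y) ↔
      ((γ w, h) : G × H) • x = x ∧ ((h, κ w) : H × K) • y = y := by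
    intro w h
    simp only [← mul_smul, Prod.mk_mul_mk, one_mul, mul_one]
    exact and_congr eq_comm eq_comm
  have step : tmk X Y x y ∈ (tensor X Y).fixedSet (pairRange γ κ) ↔
      ∀ w, ∃ h, ((γ w, h) : G × H) • x = x ∧ ((h, κ w) : H × K) • y = y := by
    rw [mem_fixedSet_pairRange]
    refine forall_congr' fun w => ?_
    rw [smul_tmk, tmk_eq_iff]
    exact exists_congr fun h => key w h
  rw [step]
  constructor
  · intro h
    choose b hb1 hb2 using h
    have hb : ∀ w w', b (w * w') = b w * b w' := by
      intro w w'
      refine hY.eq_of_smul_eq (y := y) (k := κ (w * w')) ?_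
      have e : ((b w * b w', κ (w * w')) : H × K) = (b w, κ w) * (b w', κ w') := by simp
      rw [hb2, e, mul_smul, hb2, hb2]
    exact ⟨MonoidHom.mk' b hb, mem_fixedSet_pairRange.2 hb1, mem_fixedSet_pairRange.2 hb2⟩
  · rintro ⟨β, h1, h2⟩ w
    exact ⟨β w, mem_fixedSet_pairRange.1 h1 w, mem_fixedSet_pairRange.1 h2 w⟩

/-- The fixed points on a tensor product with a left-free biset. -/
theorem card_mul_card_fixedSet_tensor [Finite H] [Finite W] {X : Biset G H} {Y : Biset H K}
    (hY : Y.LeftFree) (γ : W →* G) (κ : W →* K) :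
    Nat.card H * Nat.card ((tensor X Y).fixedSet (pairRange γ κ)) =
      ∑ β : W →* H, Nat.card (X.fixedSet (pairRange γ β)) *
        Nat.card (Y.fixedSet (pairRange β κ)) := by
  let F := (tensor X Y).fixedSet (pairRange γ κ)
  -- The pairs `(x, y)` lying over fixed points are counted twice. By `β`, which is determined by
  -- `y` and `κ`, they give the sum on the right; by fibres of `X × Y → X ×_H Y`, which are free
  -- `H`-orbits, they give the left side.
  let P := {p : X.carrier × Y.carrier // tmk X Y p.1 p.2 ∈ F}
  have e1 : Nat.card (Σ β : W →* H, X.fixedSet (pairRange γ β) × Y.fixedSet (pairRange β κ)) =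
      Nat.card P := by
    refine Nat.card_eq_of_bijective (fun s => (⟨(s.2.1, s.2.2),
      (tmk_mem_fixedSet_iff hY).2 ⟨s.1, s.2.1.2, s.2.2.2⟩⟩ : P)) ⟨?_, ?_⟩
    · rintro ⟨β, ⟨x, hx⟩, ⟨y, hy⟩⟩ ⟨β', ⟨x', hx'⟩, ⟨y', hy'⟩⟩ h
      obtain ⟨h1, h2⟩ := Prod.ext_iff.1 (congrArg Subtype.val h)
      obtain rfl : x = x' := h1
      obtain rfl : y = y' := h2
      obtain rfl : β = β' := MonoidHom.ext fun w => hY.eq_of_smul_eq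
        ((mem_fixedSet_pairRange.1 hy w).trans (mem_fixedSet_pairRange.1 hy' w).symm)
      rfl
    · rintro ⟨⟨x, y⟩, h⟩
      obtain ⟨β, h1, h2⟩ := (tmk_mem_fixedSet_iff hY).1 h
      exact ⟨⟨β, ⟨x, h1⟩, ⟨y, h2⟩⟩, rfl⟩
  have e2 : Nat.card (H × F) = Nat.card P := by
    have hsurj : ∀ t : F, ∃ p : X.carrier × Y.carrier, tmk X Y p.1 p.2 = t := fun t => by
      obtain ⟨x, y, h⟩ := tmk_surj t.1
      exact ⟨(x, y), h⟩
    -- A base point in each fibre identifies the fibre with `H`.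
    choose r hr using hsurj
    have hmk : ∀ (h : H) (t : F),
        tmk X Y (((1, h) : G × H) • (r t).1) (((h, 1) : H × K) • (r t).2) = t := fun h t => by
      rw [← hr t]
      exact (tmk_eq_iff.2 ⟨h, rfl, rfl⟩).symm
    refine Nat.card_eq_of_bijective (fun s => (⟨(((1, s.1) : G × H) • (r s.2).1,
      ((s.1, 1) : H × K) • (r s.2).2), (hmk s.1 s.2).symm ▸ s.2.2⟩ : P)) ⟨?_, ?_⟩
    · rintro ⟨h, t⟩ ⟨h', t'⟩ e
      obtain ⟨h1, h2⟩ := Prod.ext_iff.1 (congrArg Subtype.val e)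
      dsimp only at h1 h2
      obtain rfl : t = t' := by
        refine Subtype.ext ?_
        rw [← hmk h t, h1, h2, hmk h' t']
      rw [hY.eq_of_smul_eq h2]
    · rintro ⟨⟨x, y⟩, h⟩
      obtain ⟨k, h1, h2⟩ := tmk_eq_iff.1 (hr ⟨_, h⟩)
      exact ⟨(k, ⟨_, h⟩), Subtype.ext (Prod.ext h1.symm h2.symm)⟩
  rw [← Nat.card_prod]
  refine e2.trans (e1.symm.trans ?_)
  rw [Nat.card_sigma]
  simp only [Nat.card_prod]

theorem leftFree_coset [Finite H] [Finite K] {L : Subgroup (H × K)}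
    (hL : L ∈ leftFreeSubgroups H K) : (coset L).LeftFree := by
  rintro ⟨x⟩ h e
  have h1 : (((h, 1) : H × K) * x)⁻¹ * x ∈ L := QuotientGroup.eq.1 e
  have h2 := mem_leftFree_iff.1 hL (x.1⁻¹ * h⁻¹ * x.1) (by
    convert h1 using 1
    ext <;> simp)
  have h3 : h⁻¹ = 1 := by
    have := congrArg (fun z => x.1 * z * x.1⁻¹) h2
    simpa [mul_assoc] using this
  simpa using h3

end Biset

/-- The marks of a product, the second factor being left-free. -/
theorem DoubleBurnside.card_mul_mark_tensor [Finite H] [Finite K] [Finite W]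
    (a : DoubleBurnside G H) {T : Set (Subgroup (H × K))} (hT : T ⊆ leftFreeSubgroups H K)
    {b : DoubleBurnside H K} (hb : b ∈ restricted T) (γ : W →* G) (κ : W →* K) :
    (Nat.card H : ℤ) * mark (pairRange γ κ) (tensor a b) =
      ∑ β : W →* H, mark (pairRange γ β) a * mark (pairRange β κ) b := by
  induction a using cls_induction with
  | h0 => simp
  | ha x y hx hy => simp [hx, hy, add_mul, mul_add, Finset.sum_add_distrib]
  | hn x hx => simp [hx]
  | hc X =>
    induction hb using AddSubgroup.closure_induction with
    | zero => simp
    | add x y _ _ hx hy => simp [hx, hy, mul_add, Finset.sum_add_distrib]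
    | neg x _ hx => simp [hx]
    | mem x hx =>
      obtain ⟨L, hL, rfl⟩ := hx
      simp only [tensor_cls, mark_cls]
      exact_mod_cast Biset.card_mul_card_fixedSet_tensor (Biset.leftFree_coset (hT hL)) γ κ

theorem ScalarBurnside.card_mul_mark_tensor {R : Type w} [CommRing R] [Finite H] [Finite K]
    [Finite W] (a : ScalarBurnside R G H) {T : Set (Subgroup (H × K))}
    (hT : T ⊆ leftFreeSubgroups H K) {b : ScalarBurnside R H K}
    (hb : b ∈ extend R (DoubleBurnside.restricted T)) (γ : W →* G) (κ : W →* K) :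
    (Nat.card H : R) * mark R (pairRange γ κ) (tensor R a b) =
      ∑ β : W →* H, mark R (pairRange γ β) a * mark R (pairRange β κ) b := by
  induction a using TensorProduct.induction_on with
  | zero => simp
  | add x y hx hy => simp [hx, hy, add_mul, mul_add, Finset.sum_add_distrib]
  | tmul r x =>
    induction hb using Submodule.span_induction with
    | zero => simp
    | add x y _ _ hx hy => simp [hx, hy, mul_add, Finset.sum_add_distrib]
    | smul s x _ hx =>
      simp only [map_smul, smul_eq_mul]
      rw [mul_left_comm, hx, Finset.mul_sum]
      exact Finset.sum_congr rfl fun _ _ => mul_left_comm _ _ _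
    | mem y hy =>
      obtain ⟨b, hb, rfl⟩ := hy
      have h := congrArg (Int.cast (R := R)) (DoubleBurnside.card_mul_mark_tensor x hT hb γ κ)
      push_cast at h
      simp only [tensor_tmul, mark_tmul, mul_one, one_mul]
      rw [mul_left_comm, h, Finset.mul_sum]
      exact Finset.sum_congr rfl fun _ _ => (mul_assoc _ _ _).symm

end PairRange

/-! ### The degree of a subgroup and its additivity. -/

section Degree

variable {G H K W : Type u} [Group G] [Group H] [Group K] [Group W]

/-- The composition length of `k₂(L)`; for `L = {(α(h), h) | h ∈ V}` this is the composition length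
of the kernel of `α`. -/
noncomputable def subgroupDegree (L : Subgroup (G × H)) : ℕ := compositionLength (kTwo L)

/-- `κ` maps `ker γ` onto `k₂` of the image, with kernel `ker κ ⊓ ker γ`. -/
theorem subgroupDegree_pairRange [Finite W] (γ : W →* G) (κ : W →* H) :
    compositionLength γ.ker =
      compositionLength (κ.ker ⊓ γ.ker : Subgroup W) + subgroupDegree (pairRange γ κ) := by
  let f : γ.ker →* kTwo (pairRange γ κ) :=
    (κ.comp γ.ker.subtype).codRestrict _ fun w => ⟨w.1, Prod.ext w.2 rfl⟩
  have hf : Function.Surjective f := by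
    rintro ⟨h, w, hw⟩
    obtain ⟨h1, h2⟩ := Prod.ext_iff.1 hw
    exact ⟨⟨w, h1⟩, Subtype.ext h2⟩
  let e : f.ker ≃* (κ.ker ⊓ γ.ker : Subgroup W) :=
    { toFun := fun x => ⟨x.1.1, congrArg Subtype.val x.2, x.1.2⟩
      invFun := fun x => ⟨⟨x.1, x.2.2⟩, Subtype.ext x.2.1⟩
      left_inv := fun _ => rfl
      right_inv := fun _ => rfl
      map_mul' := fun _ _ => rfl }
  rw [compositionLength_eq_add f hf, compositionLength_congr e]
  rfl

theorem subgroupDegree_pairRange_of_injective [Finite W] (γ : W →* G) {κ : W →* H}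
    (hκ : Function.Injective κ) :
    subgroupDegree (pairRange γ κ) = compositionLength γ.ker := by
  have : Subsingleton (κ.ker ⊓ γ.ker : Subgroup W) := by
    rw [(MonoidHom.ker_eq_bot_iff κ).2 hκ, bot_inf_eq]
    infer_instance
  rw [subgroupDegree_pairRange γ κ, compositionLength_eq_zero_iff.2 this, zero_add]

/-- Writing `l` for composition length, the three degrees are `l(ker γ)`, `l(ker γ) - l(ker β)` and
`l(ker β)`. This is why products of homogeneous elements are homogeneous. -/
theorem subgroupDegree_add [Finite W] {γ : W →* G} {β : W →* H} {κ : W →* K}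
    (hκ : Function.Injective κ) (h : β.ker ≤ γ.ker) :
    subgroupDegree (pairRange γ κ) =
      subgroupDegree (pairRange γ β) + subgroupDegree (pairRange β κ) := by
  rw [subgroupDegree_pairRange_of_injective γ hκ, subgroupDegree_pairRange_of_injective β hκ,
    subgroupDegree_pairRange γ β, inf_eq_left.2 h, add_comm]

theorem subgroupDegree_conj [Finite H] (g : G × H) (M : Subgroup (G × H)) :
    subgroupDegree (conjSubgroup g M) = subgroupDegree M := by
  have h : kTwo (conjSubgroup g M) = conjSubgroup g.2 (kTwo M) := by
    ext x
    rw [mem_conjSubgroup]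
    change (1, x) ∈ conjSubgroup g M ↔ (1, g.2⁻¹ * x * g.2) ∈ M
    rw [mem_conjSubgroup]
    have : g⁻¹ * (1, x) * g = (1, g.2⁻¹ * x * g.2) := by ext <;> simp
    rw [this]
  exact (compositionLength_congr (((kTwo M).equivMapOfInjective _ (MulAut.conj g.2).injective).trans
    (MulEquiv.subgroupCongr h.symm))).symm

theorem subgroupDegree_eq_zero_iff [Finite H] {M : Subgroup (G × H)} :
    subgroupDegree M = 0 ↔ kTwo M = ⊥ := by
  rw [subgroupDegree, compositionLength_eq_zero_iff]
  exact ⟨fun _ => Subgroup.eq_bot_of_subsingleton _, fun h => h ▸ inferInstance⟩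

theorem snd_injective_of_leftFree {M : Subgroup (G × H)} (hM : M ∈ leftFreeSubgroups G H) :
    Function.Injective ((MonoidHom.snd G H).comp M.subtype) := by
  rw [injective_iff_map_eq_one]
  rintro ⟨⟨g, h⟩, hm⟩ (rfl : h = 1)
  obtain rfl := mem_leftFree_iff.1 hM g hm
  rfl

namespace EpiTriple

theorem toSubgroup_eq (t : EpiTriple G H) :
    t.toSubgroup = pairRange (t.U.subtype.comp t.α) t.V.subtype := rfl

theorem toSubgroup_mem_leftFree (t : EpiTriple G H) : t.toSubgroup ∈ leftFreeSubgroups G H := by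
  rw [toSubgroup_eq, pairRange_mem_leftFree,
    (MonoidHom.ker_eq_bot_iff _).2 t.V.subtype_injective]
  exact bot_le

theorem subgroupDegree_toSubgroup [Finite H] (t : EpiTriple G H) :
    subgroupDegree t.toSubgroup = compositionLength t.α.ker := by
  rw [toSubgroup_eq, subgroupDegree_pairRange_of_injective _ t.V.subtype_injective,
    MonoidHom.ker_comp_of_injective _ _ t.U.subtype_injective]

/-- A left-free subgroup is the graph of a function of its second coordinate. This lets triples be
replaced by subgroups throughout. -/
theorem exists_toSubgroup_eq {M : Subgroup (G × H)} (hM : M ∈ leftFreeSubgroups G H) :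
    ∃ t : EpiTriple G H, t.toSubgroup = M := by
  let γ := (MonoidHom.fst G H).comp M.subtype
  let e := MonoidHom.ofInjective (snd_injective_of_leftFree hM)
  refine ⟨⟨γ.range, _, γ.rangeRestrict.comp e.symm.toMonoidHom,
    γ.rangeRestrict_surjective.comp e.symm.surjective⟩, ?_⟩
  conv_rhs => rw [← pairRange_fst_snd M]
  ext x
  constructor
  · rintro ⟨v, rfl⟩
    obtain ⟨w, rfl⟩ := e.surjective v
    exact ⟨w, Prod.ext (congrArg γ (e.symm_apply_apply w).symm) rfl⟩
  · rintro ⟨w, rfl⟩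
    exact ⟨e w, Prod.ext (congrArg γ (e.symm_apply_apply w)) rfl⟩

end EpiTriple

end Degree

/-! ### The graded pieces in terms of marks, and part (a). -/

namespace BisetSystem

open DoubleBurnside

variable {ι : Type v} {Γ : ι → Type u} [∀ i, Group (Γ i)] [∀ i, Finite (Γ i)]
  {R : Type w} [CommRing R] (S : BisetSystem Γ)

theorem mark_eq_zero_of_mem_restricted {i j : ι} {a : DoubleBurnside (Γ i) (Γ j)}
    (ha : a ∈ restricted (S.sub i j)) {M : Subgroup (Γ i × Γ j)} (hM : M ∉ S.sub i j) :
    mark M a = 0 :=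
  DoubleBurnside.mark_eq_zero_of_mem_restricted (fun _ hL _ => S.le_mem hL)
    (fun _ hL => S.conj_mem hL) ha hM

theorem mark_eq_zero_of_mem_burnside {i j : ι} {x : ScalarBurnside R (Γ i) (Γ j)}
    (hx : x ∈ S.burnside R i j) {M : Subgroup (Γ i × Γ j)} (hM : M ∉ S.sub i j) :
    ScalarBurnside.mark R M x = 0 :=
  ScalarBurnside.mark_eq_zero_of_mem_extend
    (fun _ ha => S.mark_eq_zero_of_mem_restricted ha hM) hx

theorem conjElement_mem {i j : ι} {M : Subgroup (Γ i × Γ j)} (hM : M ∈ S.sub i j) :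
    conjElement M ∈ restricted (S.sub i j) :=
  conjElement_mem_restricted (fun _ hL _ => S.le_mem hL) hM

theorem mem_intGraded_iff {i j : ι} {n : ℕ} {a : DoubleBurnside (Γ i) (Γ j)} :
    a ∈ S.intGraded i j n ↔ a ∈ restricted (S.sub i j) ∧
      ∀ M ∈ leftFreeSubgroups (Γ i) (Γ j), subgroupDegree M ≠ n → mark M a = 0 := by
  rw [mem_intGraded]
  refine and_congr_right fun _ => ⟨fun h M hM hn => ?_, fun h t ht => ?_⟩
  · obtain ⟨t, rfl⟩ := EpiTriple.exists_toSubgroup_eq hM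
    exact h t (t.subgroupDegree_toSubgroup ▸ hn)
  · exact h _ t.toSubgroup_mem_leftFree (t.subgroupDegree_toSubgroup.symm ▸ ht)

/-- The marks are supported on the conjugates of `M`, and degree is invariant under conjugation. -/
theorem conjElement_mem_intGraded {i j : ι} {M : Subgroup (Γ i × Γ j)} (hM : M ∈ S.sub i j) :
    conjElement M ∈ S.intGraded i j (subgroupDegree M) := by
  rw [mem_intGraded_iff]
  refine ⟨S.conjElement_mem hM, fun L _ hL => ?_⟩
  rw [mark_conjElement]
  by_contra h
  obtain ⟨g, rfl⟩ := conjCount_ne_zero fun h' => h (by rw [h', Nat.cast_zero])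
  exact hL (subgroupDegree_conj g L).symm

theorem mem_burnside_iff {i j : ι} (hu : IsUnit (Nat.card (Γ i × Γ j) : R))
    {x : ScalarBurnside R (Γ i) (Γ j)} :
    x ∈ S.burnside R i j ↔ ∀ M, ¬ M ∈ S.sub i j → ScalarBurnside.mark R M x = 0 :=
  ScalarBurnside.mem_extend_iff hu (fun _ ha _ hM => S.mark_eq_zero_of_mem_restricted ha hM)
    fun _ hM => S.conjElement_mem hM

variable {S}

theorem mem_graded_iff (hS : ∀ i j, S.sub i j ⊆ leftFreeSubgroups (Γ i) (Γ j))
    {i j : ι} (hu : IsUnit (Nat.card (Γ i × Γ j) : R)) {n : ℕ}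
    {x : ScalarBurnside R (Γ i) (Γ j)} :
    x ∈ S.graded R i j n ↔ ∀ M, ¬ (M ∈ S.sub i j ∧ subgroupDegree M = n) →
      ScalarBurnside.mark R M x = 0 := by
  refine ScalarBurnside.mem_extend_iff hu (fun a ha M hM => ?_) fun M hM => ?_
  · obtain ⟨h1, h2⟩ := S.mem_intGraded_iff.1 ha
    by_cases h : M ∈ S.sub i j
    · exact h2 M (hS i j h) fun h' => hM ⟨h, h'⟩
    · exact S.mark_eq_zero_of_mem_restricted h1 h
  · exact hM.2 ▸ S.conjElement_mem_intGraded hM.1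

/-- In the product formula at `M`, a term vanishes unless both intermediate subgroups lie in the
system, and then their degrees add up to that of `M`. The criterion serves both the grading over `ℤ`
and the degree filtration over `R`. -/
theorem mark_tensor_eq_zero (hS : ∀ i j, S.sub i j ⊆ leftFreeSubgroups (Γ i) (Γ j))
    {i j k : ι} {x : ScalarBurnside R (Γ i) (Γ j)}
    {y : ScalarBurnside R (Γ j) (Γ k)} (hx : x ∈ S.burnside R i j) (hy : y ∈ S.burnside R j k)
    {M : Subgroup (Γ i × Γ k)} (hM : M ∈ leftFreeSubgroups (Γ i) (Γ k))
    (h : ∀ L ∈ S.sub i j, ∀ N ∈ S.sub j k,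
      subgroupDegree M = subgroupDegree L + subgroupDegree N →
      ScalarBurnside.mark R L x * ScalarBurnside.mark R N y = 0) :
    (Nat.card (Γ j) : R) * ScalarBurnside.mark R M (ScalarBurnside.tensor R x y) = 0 := by
  rw [← pairRange_fst_snd M, ScalarBurnside.card_mul_mark_tensor x (hS j k) hy]
  refine Finset.sum_eq_zero fun β _ => ?_
  by_cases h1 : pairRange ((MonoidHom.fst _ _).comp M.subtype) β ∈ S.sub i j
  · by_cases h2 : pairRange β ((MonoidHom.snd _ _).comp M.subtype) ∈ S.sub j k
    · refine h _ h1 _ h2 ?_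
      rw [← subgroupDegree_add (snd_injective_of_leftFree hM)
        (pairRange_mem_leftFree.1 (hS i j h1)), pairRange_fst_snd]
    · rw [S.mark_eq_zero_of_mem_burnside hy h2, mul_zero]
  · rw [S.mark_eq_zero_of_mem_burnside hx h1, zero_mul]

theorem tensor_mem_intGraded (hS : ∀ i j, S.sub i j ⊆ leftFreeSubgroups (Γ i) (Γ j))
    {i j k : ι} {m n : ℕ} {a : DoubleBurnside (Γ i) (Γ j)}
    {b : DoubleBurnside (Γ j) (Γ k)} (ha : a ∈ S.intGraded i j m) (hb : b ∈ S.intGraded j k n) :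
    DoubleBurnside.tensor a b ∈ S.intGraded i k (m + n) := by
  rw [mem_intGraded_iff] at *
  refine ⟨S.tensor_mem_restricted ha.1 hb.1, fun M hM hd => ?_⟩
  -- The scalars are `ℤ`, where the factor `|Γ j|` can be cancelled; over a general `R` it might be
  -- a zero divisor.
  have h := mark_tensor_eq_zero (R := ℤ) hS (ScalarBurnside.mem_extend_of_mem ha.1)
    (ScalarBurnside.mem_extend_of_mem hb.1) hM (by
      intro L hL N hN h
      simp only [ScalarBurnside.mark_one_tmul, Int.cast_id]
      by_cases h1 : subgroupDegree L = m
      · rw [hb.2 N (hS j k hN) (by omega), mul_zero]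
      · rw [ha.2 L (hS i j hL) h1, zero_mul])
  rw [ScalarBurnside.tensor_tmul, mul_one, ScalarBurnside.mark_one_tmul, Int.cast_id] at h
  exact (mul_eq_zero.1 h).resolve_left (Nat.cast_ne_zero.2 Nat.card_pos.ne')

theorem tensor_mem_graded (hS : ∀ i j, S.sub i j ⊆ leftFreeSubgroups (Γ i) (Γ j))
    {i j k : ι} {m n : ℕ} {a : ScalarBurnside R (Γ i) (Γ j)}
    {b : ScalarBurnside R (Γ j) (Γ k)} (ha : a ∈ S.graded R i j m) (hb : b ∈ S.graded R j k n) :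
    ScalarBurnside.tensor R a b ∈ S.graded R i k (m + n) := by
  induction ha using Submodule.span_induction with
  | zero => simp
  | add x y _ _ hx hy => simpa using add_mem hx hy
  | smul r x _ hx => simpa using Submodule.smul_mem _ r hx
  | mem x hx =>
    obtain ⟨a, ha, rfl⟩ := hx
    induction hb using Submodule.span_induction with
    | zero => simp
    | add x y _ _ hx hy => simpa using add_mem hx hy
    | smul r x _ hx => simpa using Submodule.smul_mem _ r hx
    | mem y hy =>
      obtain ⟨b, hb, rfl⟩ := hy
      dsimp only
      rw [ScalarBurnside.tensor_tmul, mul_one]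
      exact ScalarBurnside.mem_extend_of_mem (tensor_mem_intGraded hS ha hb)

end BisetSystem

/-! ### The graded algebra of part (b), and nilpotence of the positive part. -/

theorem nonempty_gradedAlgebra_of_iSupIndep {R : Type*} {A : Type*} [CommRing R] [Ring A]
    [Algebra R A] {B : ℕ → Submodule R A} (h1 : SetLike.GradedMonoid B) (h2 : iSupIndep B)
    (h3 : iSup B = ⊤) : Nonempty (GradedAlgebra B) :=
  ⟨{ h1, ((DirectSum.isInternal_submodule_iff_iSupIndep_and_iSup_eq_top B).2
    ⟨h2, h3⟩).chooseDecomposition with }⟩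

theorem isUnit_card_prod {R : Type w} [CommRing R] {G : Type u} (hu : IsUnit (Nat.card (G) : R)) :
    IsUnit (Nat.card (G × G) : R) := by
  rw [Nat.card_prod, Nat.cast_mul]
  exact hu.mul hu

namespace BisetSystem

open DoubleBurnside

variable {ι : Type v} {Γ : ι → Type u} [∀ i, Group (Γ i)] [∀ i, Finite (Γ i)]
  {R : Type w} [CommRing R] (S : BisetSystem Γ)

/-- The marks as linear forms on the algebra `R B^S(G, G)`. -/
noncomputable def algebraMark {i : ι} (M : Subgroup (Γ i × Γ i)) : S.algebra R i →ₗ[R] R :=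
  ScalarBurnside.mark R M ∘ₗ (S.algebra R i).val.toLinearMap

theorem algebraMark_apply {i : ι} (M : Subgroup (Γ i × Γ i)) (x : S.algebra R i) :
    S.algebraMark M x = ScalarBurnside.mark R M (x : ScalarBurnside R (Γ i) (Γ i)) := rfl

theorem mem_burnside_of_mem_algebra {i : ι} (x : S.algebra R i) :
    (x : ScalarBurnside R (Γ i) (Γ i)) ∈ S.burnside R i i := x.2

theorem algebraMark_eq_zero {i : ι} {M : Subgroup (Γ i × Γ i)} (hM : M ∉ S.sub i i)
    (x : S.algebra R i) : S.algebraMark M x = 0 :=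
  S.mark_eq_zero_of_mem_burnside (S.mem_burnside_of_mem_algebra x) hM

/-- The element `conjElement M` as an element of the algebra `R B^S(G, G)`. -/
noncomputable def algebraElement {i : ι} {M : Subgroup (Γ i × Γ i)} (hM : M ∈ S.sub i i) :
    S.algebra R i :=
  ⟨1 ⊗ₜ conjElement M, ScalarBurnside.mem_extend_of_mem (S.conjElement_mem hM)⟩

theorem algebraMark_algebraElement {i : ι} {M L : Subgroup (Γ i × Γ i)} (hM : M ∈ S.sub i i) :
    S.algebraMark L (S.algebraElement hM : S.algebra R i) = conjCount L M := by
  rw [algebraMark_apply]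
  change ScalarBurnside.mark R L (1 ⊗ₜ conjElement M) = _
  rw [ScalarBurnside.mark_one_tmul, mark_conjElement, Int.cast_natCast]

theorem eq_zero_of_algebraMark_eq_zero {i : ι} (hu : IsUnit (Nat.card (Γ i) : R))
    {x : S.algebra R i} (hx : ∀ M ∈ S.sub i i, S.algebraMark M x = 0) : x = 0 := by
  refine Subtype.ext (ScalarBurnside.eq_zero_of_mark_eq_zero (isUnit_card_prod hu) fun M => ?_)
  by_cases hM : M ∈ S.sub i i
  · exact hx M hM
  · exact S.algebraMark_eq_zero hM x

/-- An element of the algebra `R B^S(G, G)` lies in every submodule containing the basic elements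
at the subgroups at which its mark does not vanish. -/
theorem mem_of_algebraElement_mem {i : ι} (hu : IsUnit (Nat.card (Γ i) : R))
    {N : Submodule R (S.algebra R i)} {x : S.algebra R i}
    (h : ∀ M, ∀ hM : M ∈ S.sub i i, S.algebraMark M x ≠ 0 → S.algebraElement hM ∈ N) : x ∈ N := by
  classical
  have hsum : ∑ M : Subgroup (Γ i × Γ i), S.algebraMark M x •
      (if hM : M ∈ S.sub i i then S.algebraElement hM else 0) =
      (Nat.card (Γ i × Γ i) : R) • x := by
    refine Subtype.ext ?_
    rw [← Subalgebra.coe_val, map_sum]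
    change _ = (Nat.card (Γ i × Γ i) : R) • (x : ScalarBurnside R (Γ i) (Γ i))
    rw [← ScalarBurnside.sum_mark_conjElement (isUnit_card_prod hu)]
    refine Finset.sum_congr rfl fun M _ => ?_
    by_cases hM : M ∈ S.sub i i
    · rw [dif_pos hM]
      rfl
    · rw [S.algebraMark_eq_zero hM, zero_smul, map_zero,
        S.mark_eq_zero_of_mem_burnside (S.mem_burnside_of_mem_algebra x) hM, zero_smul]
  refine (Submodule.smul_mem_iff_of_isUnit _ (isUnit_card_prod hu)).1 (hsum ▸ sum_mem fun M _ => ?_)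
  by_cases hM : M ∈ S.sub i i
  · by_cases hx : S.algebraMark M x = 0
    · rw [hx, zero_smul]
      exact zero_mem _
    · rw [dif_pos hM]
      exact Submodule.smul_mem _ _ (h M hM hx)
  · rw [dif_neg hM]
    exact Submodule.smul_mem _ _ (zero_mem _)

theorem algebraElement_mem_algebraGraded {i : ι} {M : Subgroup (Γ i × Γ i)} (hM : M ∈ S.sub i i) :
    S.algebraElement hM ∈ S.algebraGraded R i (subgroupDegree M) :=
  ScalarBurnside.mem_extend_of_mem (S.conjElement_mem_intGraded hM)

theorem module_finite_algebra {i : ι} (hu : IsUnit (Nat.card (Γ i) : R)) :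
    Module.Finite R (S.algebra R i) := by
  let f : {M // M ∈ S.sub i i} → S.algebra R i := fun M => S.algebraElement M.2
  refine ⟨Submodule.fg_def.2 ⟨Set.range f, Set.finite_range f, ?_⟩⟩
  rw [eq_top_iff]
  intro x _
  exact S.mem_of_algebraElement_mem hu fun M hM _ => Submodule.subset_span ⟨⟨M, hM⟩, rfl⟩

theorem mem_algebraBifree_iff {i : ι} (hu : IsUnit (Nat.card (Γ i) : R)) {x : S.algebra R i} :
    x ∈ S.algebraBifree R i ↔ ∀ M ∉ S.bifree.sub i i, S.algebraMark M x = 0 :=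
  S.bifree.mem_burnside_iff (isUnit_card_prod hu)

variable {S}

/-- Twisted diagonal means left-free with trivial `k₂`, and only the trivial group has composition
length 0. -/
theorem mem_bifree_iff (hS : ∀ i j, S.sub i j ⊆ leftFreeSubgroups (Γ i) (Γ j)) {i j : ι}
    {M : Subgroup (Γ i × Γ j)} :
    M ∈ S.bifree.sub i j ↔ M ∈ S.sub i j ∧ subgroupDegree M = 0 := by
  refine and_congr_right fun hM => ?_
  rw [mem_twistedDiagonals_iff, subgroupDegree_eq_zero_iff]
  exact and_iff_right (hS i j hM)

theorem mem_algebraGraded_iff (hS : ∀ i j, S.sub i j ⊆ leftFreeSubgroups (Γ i) (Γ j)) {i : ι}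
    (hu : IsUnit (Nat.card (Γ i) : R)) {n : ℕ} {x : S.algebra R i} :
    x ∈ S.algebraGraded R i n ↔ ∀ M, subgroupDegree M ≠ n → S.algebraMark M x = 0 := by
  refine (mem_graded_iff hS (isUnit_card_prod hu)).trans ⟨fun h M hM => h M fun h' => hM h'.2,
    fun h M hM => ?_⟩
  by_cases h1 : M ∈ S.sub i i
  · exact h M fun h2 => hM ⟨h1, h2⟩
  · exact S.algebraMark_eq_zero h1 x

theorem algebraGraded_zero (hS : ∀ i j, S.sub i j ⊆ leftFreeSubgroups (Γ i) (Γ j)) {i : ι}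
    (hu : IsUnit (Nat.card (Γ i) : R)) : S.algebraGraded R i 0 = S.algebraBifree R i := by
  ext x
  refine (mem_graded_iff hS (isUnit_card_prod hu)).trans ?_
  rw [S.mem_algebraBifree_iff hu]
  refine forall_congr' fun M => ?_
  rw [mem_bifree_iff hS]
  rfl

-- `(1, h)` moves every point of the regular biset unless `h = 1`, so a subgroup with a fixed point
-- has trivial `k₂`.
variable (S) in
theorem one_mem_intGraded (i : ι) : 1 ∈ S.intGraded i i 0 := by
  rw [mem_intGraded_iff]
  refine ⟨S.one_mem_restricted i, fun M _ hd => ?_⟩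
  rw [one_def, mark_cls]
  have : IsEmpty ((Biset.regular (Γ i)).fixedSet M) := by
    refine ⟨fun ⟨x, hx⟩ => hd ?_⟩
    rw [subgroupDegree_eq_zero_iff, Subgroup.eq_bot_iff_forall]
    intro h hh
    change Γ i at x
    have : (1 : Γ i) * x * h⁻¹ = x := hx _ hh
    simpa using this
  rw [Nat.card_of_isEmpty, Nat.cast_zero]

theorem gradedMonoid_algebraGraded (hS : ∀ i j, S.sub i j ⊆ leftFreeSubgroups (Γ i) (Γ j))
    (i : ι) : SetLike.GradedMonoid (S.algebraGraded R i) where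
  one_mem := ScalarBurnside.mem_extend_of_mem (S.one_mem_intGraded i)
  mul_mem := by
    intro m n x y hx hy
    change ((x * y : S.algebra R i) : ScalarBurnside R (Γ i) (Γ i)) ∈ S.graded R i i (m + n)
    rw [Subalgebra.coe_mul, ScalarBurnside.mul_eq_tensor]
    exact tensor_mem_graded hS hx hy

/-- An element of the intersection has no marks of degree `n`, as it lies in the sum of the other
pieces, and none of any other degree, as it lies in piece `n`. -/
theorem iSupIndep_algebraGraded (hS : ∀ i j, S.sub i j ⊆ leftFreeSubgroups (Γ i) (Γ j)) {i : ι}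
    (hu : IsUnit (Nat.card (Γ i) : R)) : iSupIndep (S.algebraGraded R i) := by
  intro n
  rw [Submodule.disjoint_def]
  intro x hx hx'
  refine S.eq_zero_of_algebraMark_eq_zero hu fun M _ => ?_
  by_cases hn : subgroupDegree M = n
  · have hle : ⨆ (m) (_ : m ≠ n), S.algebraGraded R i m ≤ LinearMap.ker (S.algebraMark M) :=
      iSup₂_le fun m hm y hy => (mem_algebraGraded_iff hS hu).1 hy M (hn.trans_ne hm.symm)
    exact hle hx'
  · exact (mem_algebraGraded_iff hS hu).1 hx M hn

variable (S) in
theorem iSup_algebraGraded {i : ι} (hu : IsUnit (Nat.card (Γ i) : R)) :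
    iSup (S.algebraGraded R i) = ⊤ := by
  rw [eq_top_iff]
  intro x _
  exact S.mem_of_algebraElement_mem hu fun M hM _ =>
    Submodule.mem_iSup_of_mem _ (S.algebraElement_mem_algebraGraded hM)

theorem nonempty_gradedAlgebra (hS : ∀ i j, S.sub i j ⊆ leftFreeSubgroups (Γ i) (Γ j)) {i : ι}
    (hu : IsUnit (Nat.card (Γ i) : R)) : Nonempty (GradedAlgebra (S.algebraGraded R i)) :=
  nonempty_gradedAlgebra_of_iSupIndep (A := S.algebra R i) (gradedMonoid_algebraGraded hS i)
    (iSupIndep_algebraGraded hS hu) (S.iSup_algebraGraded hu)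

/-- The twisted diagonals in the system are its subgroups of degree 0. If those marks vanish, every
basic element needed to write `x` lies in a piece of positive degree. -/
theorem mem_iSup_algebraGraded_iff (hS : ∀ i j, S.sub i j ⊆ leftFreeSubgroups (Γ i) (Γ j)) {i : ι}
    (hu : IsUnit (Nat.card (Γ i) : R)) {x : S.algebra R i} :
    x ∈ (⨆ (n : ℕ) (_ : 1 ≤ n), S.algebraGraded R i n) ↔
      ∀ M ∈ S.bifree.sub i i, S.algebraMark M x = 0 := by
  constructor
  · intro hx M hM
    have hle : ⨆ (n : ℕ) (_ : 1 ≤ n), S.algebraGraded R i n ≤ LinearMap.ker (S.algebraMark M) :=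
      iSup₂_le fun n hn y hy => (mem_algebraGraded_iff hS hu).1 hy M (by
        rw [((mem_bifree_iff hS).1 hM).2]
        omega)
    exact hle hx
  · intro hx
    refine S.mem_of_algebraElement_mem hu fun M hM h => ?_
    have hd : subgroupDegree M ≠ 0 := fun h' => h (hx M ((mem_bifree_iff hS).2 ⟨hM, h'⟩))
    exact Submodule.mem_iSup_of_mem _ (Submodule.mem_iSup_of_mem (Nat.one_le_iff_ne_zero.2 hd)
      (S.algebraElement_mem_algebraGraded hM))

theorem isCompl_algebraBifree_iSup (hS : ∀ i j, S.sub i j ⊆ leftFreeSubgroups (Γ i) (Γ j)) {i : ι}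
    (hu : IsUnit (Nat.card (Γ i) : R)) :
    IsCompl (S.algebraBifree R i) (⨆ (n : ℕ) (_ : 1 ≤ n), S.algebraGraded R i n) := by
  constructor
  · rw [Submodule.disjoint_def]
    intro x hx hx'
    refine S.eq_zero_of_algebraMark_eq_zero hu fun M _ => ?_
    by_cases hM : M ∈ S.bifree.sub i i
    · exact (mem_iSup_algebraGraded_iff hS hu).1 hx' M hM
    · exact (S.mem_algebraBifree_iff hu).1 hx M hM
  · rw [codisjoint_iff, eq_top_iff, ← algebraGraded_zero hS hu]
    intro x _
    refine S.mem_of_algebraElement_mem hu fun M hM _ => ?_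
    have h := S.algebraElement_mem_algebraGraded (R := R) hM
    by_cases hd : subgroupDegree M = 0
    · rw [hd] at h
      exact Submodule.mem_sup_left h
    · exact Submodule.mem_sup_right (Submodule.mem_iSup_of_mem _
        (Submodule.mem_iSup_of_mem (Nat.one_le_iff_ne_zero.2 hd) h))

/-- The filtration by degree is multiplicative. -/
theorem algebraMark_mul_eq_zero (hS : ∀ i j, S.sub i j ⊆ leftFreeSubgroups (Γ i) (Γ j)) {i : ι}
    (hu : IsUnit (Nat.card (Γ i) : R)) {m n : ℕ} {x y : S.algebra R i}
    (hx : ∀ M ∈ S.sub i i, subgroupDegree M < m → S.algebraMark M x = 0)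
    (hy : ∀ M ∈ S.sub i i, subgroupDegree M < n → S.algebraMark M y = 0)
    {M : Subgroup (Γ i × Γ i)} (hM : M ∈ S.sub i i) (hd : subgroupDegree M < m + n) :
    S.algebraMark M (x * y) = 0 := by
  have h := mark_tensor_eq_zero hS (S.mem_burnside_of_mem_algebra x)
    (S.mem_burnside_of_mem_algebra y) (hS i i hM) (by
      intro L hL N hN h
      by_cases h1 : subgroupDegree L < m
      · rw [← algebraMark_apply, hx L hL h1, zero_mul]
      · rw [← algebraMark_apply S N, hy N hN (by omega), mul_zero])
  rw [algebraMark_apply, Subalgebra.coe_mul, ScalarBurnside.mul_eq_tensor]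
  exact hu.mul_right_eq_zero.1 h

/-- By multiplicativity of the filtration, `x ^ k` has no marks of degree below `k`, and the degrees
are bounded. -/
theorem isNilpotent_of_algebraMark_eq_zero
    (hS : ∀ i j, S.sub i j ⊆ leftFreeSubgroups (Γ i) (Γ j)) {i : ι}
    (hu : IsUnit (Nat.card (Γ i) : R)) {x : S.algebra R i}
    (hx : ∀ M ∈ S.sub i i, subgroupDegree M < 1 → S.algebraMark M x = 0) : IsNilpotent x := by
  have hpow : ∀ k : ℕ, ∀ M ∈ S.sub i i, subgroupDegree M < k → S.algebraMark M (x ^ k) = 0 := by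
    intro k
    induction k with
    | zero => exact fun M _ h => absurd h (Nat.not_lt_zero _)
    | succ k ih =>
      intro M hM hd
      rw [pow_succ]
      exact algebraMark_mul_eq_zero hS hu ih hx hM hd
  -- A crude exponent: the sum of all degrees, plus one, exceeds each of them.
  refine ⟨∑ M : Subgroup (Γ i × Γ i), subgroupDegree M + 1,
    S.eq_zero_of_algebraMark_eq_zero hu fun M hM => hpow _ M hM (Nat.lt_succ_of_le ?_)⟩
  exact Finset.single_le_sum (f := fun M => subgroupDegree M) (fun _ _ => Nat.zero_le _)
    (Finset.mem_univ M)

theorem iSup_algebraGraded_le_radical (hS : ∀ i j, S.sub i j ⊆ leftFreeSubgroups (Γ i) (Γ j))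
    {i : ι} (hu : IsUnit (Nat.card (Γ i) : R)) :
    (⨆ (n : ℕ) (_ : 1 ≤ n), S.algebraGraded R i n) ≤ S.radical R i := by
  intro x hx
  rw [mem_iSup_algebraGraded_iff hS hu] at hx
  change x ∈ Ring.jacobson (S.algebra R i)
  rw [← Ideal.jacobson_bot, Ideal.mem_jacobson_iff]
  intro y
  have hn : IsNilpotent (y * x) := by
    refine isNilpotent_of_algebraMark_eq_zero hS hu fun M hM hd => ?_
    -- With `m = 0` nothing is asked of `y`, so left multiples of `x` still have no degree 0 marks.
    -- Nilpotence then makes `y * x + 1` invertible.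
    refine algebraMark_mul_eq_zero hS hu (m := 0) (n := 1)
      (fun _ _ h => absurd h (Nat.not_lt_zero _)) (fun L hL h => hx L ?_) hM (by omega)
    exact (mem_bifree_iff hS).2 ⟨hL, by omega⟩
  obtain ⟨z, hz⟩ := (IsNilpotent.isUnit_add_one (R := S.algebra R i) hn).exists_left_inv
  refine ⟨z, ?_⟩
  rw [Ideal.mem_bot, ← hz]
  noncomm_ring

end BisetSystem

/-! ### Degree 0 marks vanish on the radical: the trace argument of part (c). -/

theorem Ring.isNilpotent_of_mem_jacobson_of_finite (F : Type*) {A : Type*} [Field F] [Ring A]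
    [Algebra F A] [Module.Finite F A] {x : A} (hx : x ∈ Ring.jacobson A) : IsNilpotent x := by
  have := IsArtinianRing.of_finite F A
  obtain ⟨n, hn⟩ := IsSemiprimaryRing.isNilpotent (R := A)
  refine ⟨n, ?_⟩
  have h : x ^ n ∈ Ring.jacobson A ^ n := Ideal.pow_mem_pow hx n
  rw [hn] at h
  exact h

section PairRange

variable {G H W : Type u} [Group G] [Group H] [Group W]

/-- Two parametrizations of a subgroup with injective first component differ by an automorphism. -/
theorem exists_mulAut_of_pairRange_eq {γ γ' : W →* G} {β β' : W →* H}
    (hγ : Function.Injective γ) (hγ' : Function.Injective γ')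
    (h : pairRange γ β = pairRange γ' β') :
    ∃ φ : MulAut W, γ = γ'.comp φ.toMonoidHom ∧ β = β'.comp φ.toMonoidHom := by
  have hr : γ.range = γ'.range := by
    have h' := congrArg (Subgroup.map (MonoidHom.fst G H)) h
    rw [pairRange, pairRange, MonoidHom.map_range, MonoidHom.map_range] at h'
    exact h'
  let φ : MulAut W := ((MonoidHom.ofInjective hγ).trans (MulEquiv.subgroupCongr hr)).trans
    (MonoidHom.ofInjective hγ').symm
  have hφ : ∀ w, γ' (φ w) = γ w := fun w =>
    congrArg Subtype.val ((MonoidHom.ofInjective hγ').apply_symm_apply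
      (MulEquiv.subgroupCongr hr (MonoidHom.ofInjective hγ w)))
  refine ⟨φ, MonoidHom.ext fun w => (hφ w).symm, MonoidHom.ext fun w => ?_⟩
  have hw : (γ w, β w) ∈ pairRange γ' β' := h ▸ ⟨w, rfl⟩
  obtain ⟨w', hw'⟩ := hw
  obtain ⟨h1, h2⟩ := Prod.ext_iff.1 hw'
  obtain rfl : w' = φ w := hγ' (h1.trans (hφ w).symm)
  exact h2.symm

theorem pairRange_comp_mulAut (γ : W →* G) (β : W →* H) (φ : MulAut W) :
    pairRange (γ.comp φ.toMonoidHom) (β.comp φ.toMonoidHom) = pairRange γ β := by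
  ext x
  constructor
  · rintro ⟨w, rfl⟩
    exact ⟨φ w, rfl⟩
  · rintro ⟨w, rfl⟩
    exact ⟨φ.symm w, Prod.ext (congrArg γ (φ.apply_symm_apply w))
      (congrArg β (φ.apply_symm_apply w))⟩

theorem pairRange_le_star {K : Type u} [Group K] (γ : W →* G) (β : W →* H) (κ : W →* K) :
    pairRange γ κ ≤ starSubgroup (pairRange γ β) (pairRange β κ) := by
  rintro _ ⟨w, rfl⟩
  exact ⟨β w, ⟨w, rfl⟩, ⟨w, rfl⟩⟩

theorem opSubgroup_pairRange (γ : W →* G) (β : W →* H) :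
    opSubgroup (pairRange γ β) = pairRange β γ := by
  ext x
  constructor
  · rintro ⟨w, hw⟩
    obtain ⟨h1, h2⟩ := Prod.ext_iff.1 hw
    exact ⟨w, Prod.ext h2 h1⟩
  · rintro ⟨w, rfl⟩
    exact ⟨w, rfl⟩

theorem conjSubgroup_swap_of_conj_pairRange {γ γ' : W →* G} {β β' : W →* H} {g : G × H}
    (h : conjSubgroup g (pairRange γ β) = pairRange γ' β') :
    conjSubgroup g.swap (pairRange β γ) = pairRange β' γ' := by
  rw [conj_pairRange] at h ⊢
  rw [← opSubgroup_pairRange γ' β', ← h, opSubgroup_pairRange]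
  rfl

end PairRange

namespace BisetSystem

variable {ι : Type v} {Γ : ι → Type u} [∀ i, Group (Γ i)]

section

variable {S : BisetSystem Γ}

theorem conj_comp_mem {i j : ι} {V : Type u} [Group V] {β : V →* Γ i} {κ : V →* Γ j}
    (h : pairRange β κ ∈ S.sub i j) (g : Γ i) :
    pairRange ((MulAut.conj g).toMonoidHom.comp β) κ ∈ S.sub i j := by
  have h' := S.conj_mem h (g, 1)
  change conjSubgroup (g, 1) _ ∈ _ at h'
  rw [conj_pairRange] at h'
  convert h'
  ext
  simp

/-- Composing the relations through `β` gives at least the pairs `(γ w, κ w)`; closure under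
subgroups does the rest. -/
theorem pairRange_mem_of_mem {i j k : ι} {V : Type u} [Group V] {γ : V →* Γ i} {β : V →* Γ j}
    {κ : V →* Γ k} (h1 : pairRange γ β ∈ S.sub i j) (h2 : pairRange β κ ∈ S.sub j k) :
    pairRange γ κ ∈ S.sub i k :=
  S.le_mem (S.star_mem h1 h2) (pairRange_le_star γ β κ)

end

variable [∀ i, Finite (Γ i)] (S : BisetSystem Γ)

/-- The injective homomorphisms from `V` to `G = Γ i` whose graph belongs to the system. -/
def Embedding (i : ι) (V : Subgroup (Γ i)) : Type u :=
  {β : V →* Γ i // Function.Injective β ∧ pairRange β V.subtype ∈ S.sub i i}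

open Classical in
noncomputable instance embeddingFintype (i : ι) (V : Subgroup (Γ i)) : Fintype (S.Embedding i V) :=
  inferInstanceAs (Fintype (Subtype _))

open Classical in
noncomputable instance embeddingDecidableEq (i : ι) (V : Subgroup (Γ i)) :
    DecidableEq (S.Embedding i V) :=
  inferInstance

variable {S}

theorem mem_autSubgroup_bifree_iff {i : ι} {V : Subgroup (Γ i)} {φ : MulAut V} :
    φ ∈ S.bifree.autSubgroup i V ↔
      pairRange (V.subtype.comp φ.toMonoidHom) V.subtype ∈ S.sub i i :=
  ⟨fun h => h.1, fun h => ⟨h, ⟨_, φ.bijective, rfl⟩⟩⟩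

/-- The order is `|Out| · |Inn V|`, and `|Inn V|` divides `|V|`, hence `|Γ i|`. -/
theorem isUnit_card_autSubgroup {R : Type w} [CommRing R] {i : ι}
    (hu : IsUnit (Nat.card (Γ i) : R)) {T : BisetSystem Γ} {V : Subgroup (Γ i)}
    (ho : IsUnit (Nat.card (T.Out i V) : R)) : IsUnit (Nat.card (T.autSubgroup i V) : R) := by
  rw [Subgroup.card_eq_card_quotient_mul_card_subgroup
    ((MulAut.conj : V →* MulAut V).range.subgroupOf (T.autSubgroup i V)), Nat.cast_mul]
  refine ho.mul (isUnit_of_dvd_unit ?_ hu)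
  refine Nat.cast_dvd_cast (Dvd.dvd.trans ?_ V.card_subgroup_dvd_card)
  rw [Nat.card_congr (Subgroup.subgroupOfEquivOfLe (T.conj_mem_autSubgroup i V)).toEquiv]
  exact Subgroup.card_range_dvd _

/-- The pairs of embeddings parametrizing a given twisted diagonal subgroup form a torsor under the
automorphism group. -/
theorem card_pairs_eq {i : ι} {V : Subgroup (Γ i)} (γ₀ β₀ : S.Embedding i V)
    (hγ₀ : ∃ g : Γ i, γ₀.1 = (MulAut.conj g).toMonoidHom.comp V.subtype) :
    Nat.card {p : S.Embedding i V × S.Embedding i V //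
      pairRange p.1.1 p.2.1 = pairRange γ₀.1 β₀.1} = Nat.card (S.bifree.autSubgroup i V) := by
  obtain ⟨g, hg⟩ := hγ₀
  have hmem : ∀ (δ : S.Embedding i V) (φ : S.bifree.autSubgroup i V),
      pairRange (δ.1.comp φ.1.toMonoidHom) V.subtype ∈ S.sub i i := by
    intro δ φ
    refine pairRange_mem_of_mem (β := V.subtype.comp φ.1.toMonoidHom) ?_
      (mem_autSubgroup_bifree_iff.1 φ.2)
    rw [pairRange_comp_mulAut]
    exact δ.2.2
  let act : S.Embedding i V → S.bifree.autSubgroup i V → S.Embedding i V := fun δ φ =>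
    ⟨δ.1.comp φ.1.toMonoidHom, δ.2.1.comp φ.1.injective, hmem δ φ⟩
  symm
  refine Nat.card_eq_of_bijective (fun φ => (⟨(act γ₀ φ, act β₀ φ),
    pairRange_comp_mulAut _ _ _⟩ : {p : S.Embedding i V × S.Embedding i V //
      pairRange p.1.1 p.2.1 = pairRange γ₀.1 β₀.1})) ⟨?_, ?_⟩
  · intro φ ψ h
    have h1 : act γ₀ φ = act γ₀ ψ := congrArg (fun p => p.1.1) h
    refine Subtype.ext (MulEquiv.ext fun v => γ₀.2.1 ?_)
    exact DFunLike.congr_fun (congrArg Subtype.val h1) v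
  · rintro ⟨⟨γ, β⟩, h⟩
    obtain ⟨φ, h1, h2⟩ := exists_mulAut_of_pairRange_eq γ.2.1 γ₀.2.1 h
    -- Since `γ = γ₀ ∘ φ` and `γ₀` is conjugation by `g` on `V`, conjugating back by `g⁻¹` shows
    -- that the graph of `φ` itself is in the system. The assumption on `γ₀` is needed here.
    have hφ : φ ∈ S.bifree.autSubgroup i V := by
      rw [mem_autSubgroup_bifree_iff]
      have h3 := conj_comp_mem γ.2.2 g⁻¹
      convert h3
      rw [h1, hg]
      ext v
      simp [mul_assoc]
    exact ⟨⟨φ, hφ⟩, Subtype.ext (Prod.ext (Subtype.ext h1.symm) (Subtype.ext h2.symm))⟩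

/-- Double counting of triples `(γ, β, g)`. For fixed `g`, the pairs `(γ, β)` parametrize one
conjugate of the target, so `card_pairs_eq` gives the same number for every `g`. -/
theorem sum_conjCount_pairRange {i : ι} {V : Subgroup (Γ i)} (β₀ : S.Embedding i V) :
    ∑ γ : S.Embedding i V, ∑ β : S.Embedding i V,
      conjCount (pairRange γ.1 β.1) (pairRange V.subtype β₀.1) =
    Nat.card (Γ i × Γ i) * Nat.card (S.bifree.autSubgroup i V) := by
  have e : Nat.card (Σ p : S.Embedding i V × S.Embedding i V,
      {g : Γ i × Γ i // conjSubgroup g (pairRange p.1.1 p.2.1) = pairRange V.subtype β₀.1}) =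
      Nat.card (Σ g : Γ i × Γ i, {p : S.Embedding i V × S.Embedding i V //
        conjSubgroup g (pairRange p.1.1 p.2.1) = pairRange V.subtype β₀.1}) :=
    Nat.card_congr
      { toFun := fun s => ⟨s.2.1, s.1, s.2.2⟩
        invFun := fun s => ⟨s.2.1, s.1, s.2.2⟩
        left_inv := fun _ => rfl
        right_inv := fun _ => rfl }
  have := Fintype.ofFinite (Γ i × Γ i)
  rw [Nat.card_sigma, Nat.card_sigma, Fintype.sum_prod_type] at e
  refine e.trans ?_
  rw [Finset.sum_congr rfl (g := fun _ => Nat.card (S.bifree.autSubgroup i V))]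
  · simp
  · intro g _
    have hV : pairRange V.subtype V.subtype ∈ S.sub i i := by
      refine S.le_mem (S.diag_mem i) ?_
      rintro _ ⟨v, rfl⟩
      exact ⟨v, rfl⟩
    let γ₁ : S.Embedding i V := ⟨(MulAut.conj g⁻¹.1).toMonoidHom.comp V.subtype,
      (MulAut.conj g⁻¹.1).injective.comp V.subtype_injective, conj_comp_mem hV _⟩
    let β₁ : S.Embedding i V := ⟨(MulAut.conj g⁻¹.2).toMonoidHom.comp β₀.1,
      (MulAut.conj g⁻¹.2).injective.comp β₀.2.1, conj_comp_mem β₀.2.2 _⟩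
    rw [← card_pairs_eq γ₁ β₁ ⟨_, rfl⟩]
    refine Nat.card_congr (Equiv.subtypeEquivRight fun p => ?_)
    rw [conjSubgroup_eq_iff, conj_pairRange]

variable (S) in
/-- The matrix of marks of an element at the pairs of embeddings of `V`. -/
noncomputable def markMatrix {R : Type w} [CommRing R] {i : ι} (V : Subgroup (Γ i))
    (x : S.algebra R i) : Matrix (S.Embedding i V) (S.Embedding i V) R :=
  Matrix.of fun γ β => S.algebraMark (pairRange γ.1 β.1) x

/-- This is the product formula once the sum over all `β : V →* Γ i` is cut down to embeddings. In a
nonzero term `ker β ≤ ker γ = ⊥`, and composing with the graph of `κ` puts the graph of `β` in the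
system. -/
theorem markMatrix_mul (hS : ∀ i j, S.sub i j ⊆ leftFreeSubgroups (Γ i) (Γ j)) {R : Type w}
    [CommRing R] {i : ι} (V : Subgroup (Γ i)) (x y : S.algebra R i) :
    S.markMatrix V x * S.markMatrix V y = (Nat.card (Γ i) : R) • S.markMatrix V (x * y) := by
  classical
  ext γ κ
  rw [Matrix.mul_apply, Matrix.smul_apply, smul_eq_mul]
  change ∑ β : S.Embedding i V, S.algebraMark (pairRange γ.1 β.1) x *
    S.algebraMark (pairRange β.1 κ.1) y = _ * S.algebraMark (pairRange γ.1 κ.1) (x * y)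
  rw [algebraMark_apply S _ (x * y), Subalgebra.coe_mul, ScalarBurnside.mul_eq_tensor,
    ScalarBurnside.card_mul_mark_tensor _ (hS i i) (S.mem_burnside_of_mem_algebra y)]
  let f : (V →* Γ i) → R := fun β => ScalarBurnside.mark R (pairRange γ.1 β) x *
    ScalarBurnside.mark R (pairRange β κ.1) y
  have h : ∀ β ∈ Finset.univ, f β ≠ 0 →
      (Function.Injective β ∧ pairRange β V.subtype ∈ S.sub i i) := by
    intro β _ hβ
    have h1 : pairRange γ.1 β ∈ S.sub i i := by
      by_contra h
      exact hβ (by simp only [f]; rw [← algebraMark_apply, S.algebraMark_eq_zero h, zero_mul])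
    have h2 : pairRange β κ.1 ∈ S.sub i i := by
      by_contra h
      exact hβ (by
        simp only [f]
        rw [← algebraMark_apply S (pairRange β κ.1), S.algebraMark_eq_zero h, mul_zero])
    refine ⟨(MonoidHom.ker_eq_bot_iff β).1 ?_, pairRange_mem_of_mem h2 κ.2.2⟩
    rw [eq_bot_iff, ← (MonoidHom.ker_eq_bot_iff γ.1).2 γ.2.1]
    exact pairRange_mem_leftFree.1 (hS i i h1)
  change _ = ∑ β : V →* Γ i, f β
  rw [← Finset.sum_filter_of_ne h]
  exact (Finset.sum_subtype _ (by simp) f).symm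

theorem isNilpotent_markMatrix (hS : ∀ i j, S.sub i j ⊆ leftFreeSubgroups (Γ i) (Γ j))
    {R : Type w} [CommRing R] {i : ι} (V : Subgroup (Γ i)) {x : S.algebra R i} {n : ℕ}
    (hx : x ^ n = 0) : IsNilpotent (S.markMatrix V x) := by
  -- Starting at the first power avoids evaluating the matrix of the identity.
  have h : ∀ k : ℕ, S.markMatrix V x ^ (k + 1) =
      (Nat.card (Γ i) : R) ^ k • S.markMatrix V (x ^ (k + 1)) := by
    intro k
    induction k with
    | zero => simp
    | succ k ih =>
      rw [pow_succ, ih, Matrix.smul_mul, markMatrix_mul hS, smul_smul, ← pow_succ, ← pow_succ]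
  refine ⟨n + 1, ?_⟩
  rw [h, pow_succ x, hx, zero_mul]
  ext γ β
  change _ * S.algebraMark (pairRange γ.1 β.1) (0 : S.algebra R i) = 0
  rw [map_zero, mul_zero]

theorem algebraMark_eq_zero_of_mem_radical
    (hS : ∀ i j, S.sub i j ⊆ leftFreeSubgroups (Γ i) (Γ j)) {R : Type w} [Field R] {i : ι}
    (hu : IsUnit (Nat.card (Γ i) : R))
    (ho : ∀ U : Subgroup (Γ i), IsUnit (Nat.card (S.bifree.Out i U) : R))
    (hop : ∀ L ∈ S.bifree.sub i i, opSubgroup L ∈ S.bifree.sub i i) {x : S.algebra R i}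
    (hx : x ∈ S.radical R i) {L : Subgroup (Γ i × Γ i)} (hL : L ∈ S.bifree.sub i i) :
    S.algebraMark L x = 0 := by
  have hop' := (hop L hL).1
  obtain ⟨hL', t, ht, rfl⟩ := hL
  let V := t.V
  let β₀ : S.Embedding i V := ⟨t.U.subtype.comp t.α, t.U.subtype_injective.comp ht.1, hL'⟩
  have hop'' : pairRange V.subtype β₀.1 ∈ S.sub i i := by
    rw [← opSubgroup_pairRange]
    exact hop'
  -- The basic element at the opposite of `L`: its entries in the trace pick out the entries of `x`
  -- at conjugates of `L`.
  let e : S.algebra R i := S.algebraElement hop''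
  have := S.module_finite_algebra hu
  have hex : e * x ∈ Ring.jacobson (S.algebra R i) := Ideal.mul_mem_left _ e hx
  obtain ⟨n, hn⟩ := Ring.isNilpotent_of_mem_jacobson_of_finite R hex
  have htr : Matrix.trace (S.markMatrix V e * S.markMatrix V x) = 0 := by
    rw [markMatrix_mul hS, Matrix.trace_smul,
      (Matrix.isNilpotent_trace_of_isNilpotent (isNilpotent_markMatrix hS V hn)).eq_zero,
      smul_zero]
  have key : Matrix.trace (S.markMatrix V e * S.markMatrix V x) =
      ((∑ γ : S.Embedding i V, ∑ β : S.Embedding i V,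
        conjCount (pairRange γ.1 β.1) (pairRange V.subtype β₀.1) : ℕ) : R) *
        S.algebraMark (pairRange β₀.1 V.subtype) x := by
    push_cast
    rw [Finset.sum_mul]
    refine Finset.sum_congr rfl fun γ _ => ?_
    rw [Finset.sum_mul, Matrix.diag_apply, Matrix.mul_apply]
    refine Finset.sum_congr rfl fun β _ => ?_
    change S.algebraMark _ e * S.algebraMark (pairRange β.1 γ.1) x = _
    rw [algebraMark_algebraElement]
    -- Where `e` has a nonzero count, swapping coordinates conjugates `(β, γ)` to the given twisted
    -- diagonal subgroup. The mark of `x` is thus the same in all these terms and factors out of the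
    -- trace.
    by_cases hc : conjCount (pairRange γ.1 β.1) (pairRange V.subtype β₀.1) = 0
    · rw [hc, Nat.cast_zero, zero_mul, zero_mul]
    · obtain ⟨g, hg⟩ := conjCount_ne_zero hc
      rw [← conjSubgroup_swap_of_conj_pairRange hg, algebraMark_apply, algebraMark_apply,
        ScalarBurnside.mark_conj]
  rw [key, sum_conjCount_pairRange, Nat.cast_mul] at htr
  exact ((isUnit_card_prod hu).mul (isUnit_card_autSubgroup hu (ho V))).mul_right_eq_zero.1 htr

theorem radical_eq (hS : ∀ i j, S.sub i j ⊆ leftFreeSubgroups (Γ i) (Γ j)) {R : Type w} [Field R]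
    {i : ι} (hu : IsUnit (Nat.card (Γ i) : R))
    (ho : ∀ U : Subgroup (Γ i), IsUnit (Nat.card (S.bifree.Out i U) : R))
    (hop : ∀ L ∈ S.bifree.sub i i, opSubgroup L ∈ S.bifree.sub i i) :
    S.radical R i = ⨆ (n : ℕ) (_ : 1 ≤ n), S.algebraGraded R i n := by
  refine le_antisymm (fun x hx => ?_) (iSup_algebraGraded_le_radical hS hu)
  rw [mem_iSup_algebraGraded_iff hS hu]
  exact fun M hM => algebraMark_eq_zero_of_mem_radical hS hu ho hop hx hM

end BisetSystem

/-! ### Assembly of the three parts. -/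

theorem theorem6p4 {ι : Type v} (Γ : ι → Type u) [∀ i, Group (Γ i)] [∀ i, Finite (Γ i)]
    (S : BisetSystem Γ) (hS : ∀ i j, S.sub i j ⊆ leftFreeSubgroups (Γ i) (Γ j)) :
    -- (a)
    (∀ (R : Type w) [CommRing R] (i j k : ι) (m n : ℕ)
      (a : ScalarBurnside R (Γ i) (Γ j)) (b : ScalarBurnside R (Γ j) (Γ k)),
      a ∈ S.graded R i j m → b ∈ S.graded R j k n →
        ScalarBurnside.tensor R a b ∈ S.graded R i k (m + n)) ∧
    -- (b)
    (∀ (R : Type w) [CommRing R] (i : ι), IsUnit (Nat.card (Γ i) : R) →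
      Nonempty (GradedAlgebra (S.algebraGraded R i)) ∧
      S.algebraGraded R i 0 = S.algebraBifree R i) ∧
    -- (c)
    (∀ (R : Type w) [Field R] (i : ι), IsUnit (Nat.card (Γ i) : R) →
      (∀ U : Subgroup (Γ i), IsUnit (Nat.card (S.bifree.Out i U) : R)) →
      (∀ L ∈ S.bifree.sub i i, opSubgroup L ∈ S.bifree.sub i i) →
      S.radical R i = (⨆ (n : ℕ) (_ : 1 ≤ n), S.algebraGraded R i n) ∧
      (∀ a : S.algebra R i, a ∈ S.radical R i ↔
        ∀ t : EpiTriple (Γ i) (Γ i), t.toSubgroup ∈ S.bifree.sub i i →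
          ScalarBurnside.mark R t.toSubgroup (a : ScalarBurnside R (Γ i) (Γ i)) = 0) ∧
      IsCompl (S.algebraBifree R i) (S.radical R i)) := by
  refine ⟨fun R _ i j k m n a b ha hb => BisetSystem.tensor_mem_graded hS ha hb,
    fun R _ i hu => ⟨BisetSystem.nonempty_gradedAlgebra hS hu,
      BisetSystem.algebraGraded_zero hS hu⟩,
    fun R _ i hu ho hop => ?_⟩
  have hJ := BisetSystem.radical_eq hS hu ho hop
  refine ⟨hJ, fun a => ?_, hJ ▸ BisetSystem.isCompl_algebraBifree_iSup hS hu⟩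
  rw [hJ, BisetSystem.mem_iSup_algebraGraded_iff hS hu]
  refine ⟨fun h t ht => h _ ht, fun h M hM => ?_⟩
  obtain ⟨t, -, rfl⟩ := hM.2
  exact h t hM
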